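/- **Fractional binomial distribution.** For $p,H\in(0,1)$ put $$m(p,H)=\min\Bigl\{1-p,\ \tfrac12\bigl(-2p+2^{2H-2}+\sqrt{4p-p\,2^{2H}+2^{4H-4}}\bigr)\Bigr\}>0,$$ and let $0\le c<m(p,H)$. The generalized Bernoulli process $(\xi_i)_{i\ge1}$ with parameters $(p,H,c)$ is the $\{0,1\}$-valued process whose law is determined by $$P(\xi_{i_0}=\xi_{i_1}=\dots=\xi_{i_r}=1)=p\prod_{j=1}^{r}\bigl(p+c\,|i_j-i_{j-1}|^{2H-2}\bigr),\qquad i_0<i_1<\dots<i_r,$$ and by inclusion–exclusion: for disjoint finite sets $A,B\subset\mathbb N$, $$P(\xi_i=1\ \forall i\in A,\ \xi_i=0\ \forall i\in B)=\sum_{B'\subseteq B}(-1)^{|B'|}P(\xi_i=1\ \forall i\in A\cup B'),$$ where the probability of the empty condition is $1$. The fractional binomial distribution $B_N(p,H,c)$ is the law of $\xi_1+\dots+\xi_N$. **Regression model.** Let $k\ge 0$ and let $N\ge 3$ be a known integer. For $x\in\mathbb R^k$ and $\beta=(\beta_0,\dots,\beta_k)\in\mathbb R^{k+1}$ write $x'\beta=\beta_0+\sum_{j=1}^k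 x_j\beta_j$, and put $\sigma(t)=1/(1+e^{-t})$. For $\Theta=(\psi,\eta,\nu)\in\mathbb R^{3(k+1)}$ let $$p=\sigma(x'\psi),\quad H=\sigma(x'\eta),\quad c^\circ=\sigma(x'\nu),\quad c=c^\circ\, m(p,H),\qquad P(y\mid x,\Theta)=P\bigl(B_N(p,H,c)=y\bigr).$$ **Theorem.** Let $(X_i,Y_i)$, $i\ge1$, be independent random pairs with values in $\mathbb R^k\times\{0,1,2,\dots\}$ such that, for some $\Theta_0\in\mathbb R^{3(k+1)}$, the conditional law of $Y_i$ given $X_i=x$ is $P(\cdot\mid x,\Theta_0)$ for every $i$. Assume: 1. the covariate vectors $X_i$ are identically distributed with a common law $g$ that is carried by a compact subset of $\mathbb R^k$; 2. for every $a\in\mathbb R^k\setminus\{0\}$, $\operatorname{Var}\bigl(\sum_{j=1}^k a_jX_{ij}\bigr)\neq0$; 3. $\Theta_0\in\mathcal C$, where $\mathcal C\subset\mathbb R^{3(k+1)}$ is a known compact set. For each $n\ge1$ let $\hat\Theta_n$ be a maximum likelihood estimator over $\mathcal C$, that is, almost surely $$\hat\Theta_n\in\operatorname*{arg\,max}_{\Theta\in\mathcal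 C}\ \prod_{i=1}^nP(Y_i\mid X_i,\Theta).$$ Then $\hat\Theta_n\to\Theta_0$ in probability as $n\to\infty$. -/

import Mathlib

open MeasureTheory ProbabilityTheory Filter

noncomputable section

/-- `∏ⱼ (p + c |iⱼ - iⱼ₋₁| ^ (2H - 2))` over the consecutive entries of a list `i₀, i₁, …, iₙ`. -/
def gbpChain (p H c : ℝ) : List ℕ → ℝ
  | [] => 1
  | [_] => 1
  | i :: j :: l => (p + c * |(j : ℝ) - (i : ℝ)| ^ (2 * H - 2)) * gbpChain p H c (j :: l)

/-- The probability that a generalized Bernoulli process `ξ` with parameters `p, H, c` has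
`ξ i = 1` for all `i ∈ A`: it is `p ∏ⱼ (p + c |iⱼ - iⱼ₋₁| ^ (2H - 2))`, where `i₀ < i₁ < ⋯` are
the elements of `A`, and `1` if `A` is empty. -/
def gbpOnes (p H c : ℝ) (A : Finset ℕ) : ℝ :=
  if A = ∅ then 1 else p * gbpChain p H c (A.sort (· ≤ ·))

/-- The probability that a generalized Bernoulli process `ξ` has `ξ i = 1` for all `i ∈ A` and
`ξ i = 0` for all `i ∈ B`, for disjoint `A` and `B` (inclusion-exclusion over subsets of `B`). -/
def gbpProb (p H c : ℝ) (A B : Finset ℕ) : ℝ :=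
  ∑ B' ∈ B.powerset, (-1 : ℝ) ^ B'.card * gbpOnes p H c (B' ∪ A)

/-- The probability mass function `P(B_N(p, H, c) = y)` of the fractional binomial distribution,
that is, of the sum `ξ 1 + ⋯ + ξ N` of a generalized Bernoulli process. -/
def fbPmf (N : ℕ) (p H c : ℝ) (y : ℕ) : ℝ :=
  ∑ A ∈ (Finset.Icc 1 N).powersetCard y, gbpProb p H c A (Finset.Icc 1 N \ A)

/-- The strict upper bound for the parameter `c` of a generalized Bernoulli process. -/
def fbCBound (p H : ℝ) : ℝ :=
  min (1 - p)
    ((1 / 2) * (-2 * p + (2 : ℝ) ^ (2 * H - 2)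
      + √(4 * p - p * (2 : ℝ) ^ (2 * H) + (2 : ℝ) ^ (4 * H - 4))))

/-- The inverse of the logit link. -/
def invLogit (t : ℝ) : ℝ := 1 / (1 + Real.exp (-t))

/-- The linear predictor `β₀ + β₁ x₁ + ⋯ + βₖ xₖ`. -/
def linPred {k : ℕ} (β : Fin (k + 1) → ℝ) (x : Fin k → ℝ) : ℝ :=
  β 0 + ∑ j : Fin k, x j * β j.succ

/-- The parameter `Θ = (ψ, η, ν)` of a fractional binomial regression with `k` covariates. -/
abbrev FBParam (k : ℕ) : Type :=
  (Fin (k + 1) → ℝ) × (Fin (k + 1) → ℝ) × (Fin (k + 1) → ℝ)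

/-- `P(y | x, Θ)`: the fractional binomial probability of `y` at the parameters
`p = invLogit (x'ψ)`, `H = invLogit (x'η)`, `c = c° * fbCBound p H` with `c° = invLogit (x'ν)`. -/
def fbRegPmf {k : ℕ} (N : ℕ) (Θ : FBParam k) (x : Fin k → ℝ) (y : ℕ) : ℝ :=
  let p := invLogit (linPred Θ.1 x)
  let H := invLogit (linPred Θ.2.1 x)
  let c₀ := invLogit (linPred Θ.2.2 x)
  fbPmf N p H (c₀ * fbCBound p H) y

/-- The likelihood `∏ i < n, P(yᵢ | xᵢ, Θ)` of the first `n` observations. -/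
def fbLikelihood {k : ℕ} (N n : ℕ) (x : ℕ → Fin k → ℝ) (y : ℕ → ℕ) (Θ : FBParam k) : ℝ :=
  ∏ i ∈ Finset.range n, fbRegPmf N Θ (x i) (y i)

/-- `Θ` is a maximum likelihood estimate within the parameter set `C`, given the first `n`
observations. -/
def IsFBMLE {k : ℕ} (N n : ℕ) (C : Set (FBParam k)) (x : ℕ → Fin k → ℝ) (y : ℕ → ℕ)
    (Θ : FBParam k) : Prop :=
  Θ ∈ C ∧ IsMaxOn (fbLikelihood N n x y) C Θ

end

/-! The proof is Wald's argument for maximum likelihood. By Gibbs' inequality the expected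
log-likelihood is maximal at `Θ₀`. If this maximizer is unique, then away from `Θ₀` a finite cover
of the compact set, the law of large numbers at its centres and equicontinuity of the log-likelihood
exclude every other value with probability tending to one
(`tendstoInMeasure_of_forall_integral_lt`). Two facts about the distribution have to be supplied.

Positivity: `log P(y | x, Θ)` must be finite and continuous for `y ≤ N`. The process is a stationary
renewal process with renewal sequence `U n = p + c (n + 1) ^ (2H - 2)`. The bound on `c` says
exactly that `U 0 < 1` and `U 0 ^ 2 < U 1`; as `U` is log-convex, Kaluza's theorem makes all
first-return probabilities positive, and since `U` decreases, so are the survival probabilities.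
Every 0-1 pattern has a probability that is a product of such factors (`gbpPattern_eq`,
`fbPmf_pos`).

Identifiability: the distribution determines its binomial moments. The first gives `p`. If two pairs
`(H, c)` with different `H` had the same second moment, the difference of their renewal sequences
would change sign once and have weighted mean zero; the third moment is a symmetric bilinear form in
the sequence, and this forces a strict inequality between the third moments (`third_moment_lt`). So
`H` is determined, and then `c` (`fbPmf_injective`). Injectivity of the logit link and nondegeneracy
of the covariates carry this over to `Θ` (`eq_of_linPred_ae_eq`). -/

/-! ### Recursions for first-renewal and survival probabilities -/

/-- For a renewal process with renewal sequence `1, U 0, U 1, …`, whose first renewal is governed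
by the sequence `v`, the probability that the first renewal happens at time `m`. -/
def renewalExcl (U : ℕ → ℝ) : (ℕ → ℝ) → ℕ → ℝ
  | v, 0 => v 0
  | v, m + 1 => renewalExcl U (fun k => v (k + 1)) m - v 0 * renewalExcl U U m

/-- For a renewal process with renewal sequence `1, U 0, U 1, …`, whose first renewal is governed
by the sequence `v`, the probability that there is no renewal before time `m`. -/
def renewalSurv (U : ℕ → ℝ) : (ℕ → ℝ) → ℕ → ℝ
  | _, 0 => 1
  | v, m + 1 => renewalSurv U (fun k => v (k + 1)) m - v 0 * renewalSurv U U m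

/-- Decomposition of a renewal at time `m` by the last renewal `i` before it. -/
theorem renewalExcl_eq (U : ℕ → ℝ) (m : ℕ) (v : ℕ → ℝ) :
    renewalExcl U v m = v m - ∑ i ∈ Finset.range m, v i * renewalExcl U U (m - 1 - i) := by
  induction m generalizing v with
  | zero => simp [renewalExcl]
  | succ m ih =>
    rw [renewalExcl, ih, Finset.sum_range_succ']
    have : ∀ i, m + 1 - 1 - (i + 1) = m - 1 - i := fun i => by omega
    simp only [this]
    simp
    ring

theorem renewalSurv_eq (U : ℕ → ℝ) (m : ℕ) (v : ℕ → ℝ) :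
    renewalSurv U v m = 1 - ∑ i ∈ Finset.range m, v i * renewalSurv U U (m - 1 - i) := by
  induction m generalizing v with
  | zero => simp [renewalSurv]
  | succ m ih =>
    rw [renewalSurv, ih, Finset.sum_range_succ']
    have : ∀ i, m + 1 - 1 - (i + 1) = m - 1 - i := fun i => by omega
    simp only [this]
    simp
    ring

theorem renewalSurv_sub_succ (U : ℕ → ℝ) (m : ℕ) (v : ℕ → ℝ) :
    renewalSurv U v m - renewalSurv U v (m + 1) = renewalExcl U v m := by
  induction m generalizing v with
  | zero => simp [renewalSurv, renewalExcl]
  | succ m ih =>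
    rw [renewalExcl, ← ih, ← ih]
    simp only [renewalSurv]
    ring

theorem renewalSurv_eq_one_sub_sum (U : ℕ → ℝ) (v : ℕ → ℝ) (m : ℕ) :
    renewalSurv U v m = 1 - ∑ i ∈ Finset.range m, renewalExcl U v i := by
  induction m with
  | zero => simp [renewalSurv]
  | succ m ih =>
    rw [Finset.sum_range_succ, ← renewalSurv_sub_succ U m v, ih]
    ring

/-- Time reversal for the stationary start: a first renewal at `m` looks, backwards from `m`, like a
renewal followed by `m` empty times. -/
theorem renewalExcl_const (U : ℕ → ℝ) (p : ℝ) (m : ℕ) :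
    renewalExcl U (fun _ => p) m = p * renewalSurv U U m := by
  induction m with
  | zero => simp [renewalSurv, renewalExcl]
  | succ m ih =>
    rw [renewalExcl, ih, ← renewalSurv_sub_succ U m U]
    ring

/-! ### Log-convex renewal sequences and Kaluza's theorem -/

/-- A nonincreasing sequence `U` of positive numbers below `1` such that `1, U 0, U 1, …` is
log-convex, strictly so in front. -/
structure IsKaluza (U : ℕ → ℝ) : Prop where
  pos : ∀ n, 0 < U n
  lt_one : ∀ n, U n < 1
  anti : Antitone U
  sq_lt : U 0 ^ 2 < U 1
  logConvex : ∀ n, U (n + 1) ^ 2 ≤ U n * U (n + 2)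

theorem IsKaluza.ratio_le {U : ℕ → ℝ} (hU : IsKaluza U) {i n : ℕ} (h : i ≤ n) :
    U (i + 1) * U n ≤ U i * U (n + 1) := by
  have hm : Monotone fun n => U (n + 1) / U n := by
    refine monotone_nat_of_le_succ fun n => ?_
    rw [div_le_div_iff₀ (hU.pos _) (hU.pos _)]
    have := hU.logConvex n
    nlinarith
  have := hm h
  simp only at this
  rw [div_le_div_iff₀ (hU.pos _) (hU.pos _)] at this
  linarith

/-- The ratios `U (n + 1) / U n` are nondecreasing, and the first one already exceeds `U 0`. -/
theorem IsKaluza.mul_lt {U : ℕ → ℝ} (hU : IsKaluza U) (n : ℕ) :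
    U 0 * U n < U (n + 1) := by
  have h := hU.ratio_le (Nat.zero_le n)
  have h0 := hU.pos 0
  have hn := hU.pos n
  have := hU.sq_lt
  simp only [zero_add] at h
  have h2 : U 0 ^ 2 * U n < U 0 * U (n + 1) := lt_of_lt_of_le (by gcongr) h
  nlinarith

/-- Kaluza's theorem: the first return probabilities of a log-convex renewal sequence are
positive. -/
theorem IsKaluza.renewalExcl_pos {U : ℕ → ℝ} (hU : IsKaluza U) (n : ℕ) :
    0 < renewalExcl U U n := by
  induction n using Nat.strong_induction_on with
  | _ n ih =>
    rcases n with _ | n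
    · simpa [renewalExcl] using hU.pos 0
    · set f := renewalExcl U U with hf
      have e1 : f (n + 1) = U (n + 1) - ∑ i ∈ Finset.range (n + 1), U i * f (n - i) := by
        have := renewalExcl_eq U (n + 1) U
        simpa using this
      have e2 : U n = f n + ∑ i ∈ Finset.range n, U i * f (n - 1 - i) := by
        have := renewalExcl_eq U n U
        linarith
      rw [Finset.sum_range_succ'] at e1
      -- Scaling the identity for `f (n + 1)` by `U n` and the one for `U n` by `U (n + 1)` makes
      -- the two sums comparable term by term; what remains is `f (n + 1) * U n ≥ f n * (U (n + 1) -
      -- U 0 * U n)`.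
      have hpt : ∀ i ∈ Finset.range n, U (i + 1) * f (n - (i + 1)) * U n ≤
          U i * f (n - 1 - i) * U (n + 1) := by
        intro i hi
        rw [Finset.mem_range] at hi
        have h1 := hU.ratio_le hi.le
        have h2 := ih (n - 1 - i) (by omega)
        have h3 : n - (i + 1) = n - 1 - i := by omega
        rw [h3]
        nlinarith
      have hs := Finset.sum_le_sum hpt
      rw [← Finset.sum_mul, ← Finset.sum_mul] at hs
      have hfn := ih n (by omega)
      have hlt := hU.mul_lt n
      have hn := hU.pos n
      simp only [Nat.sub_zero] at e1
      have : 0 < f (n + 1) * U n := by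
        have e3 : U (n + 1) * U n = U (n + 1) * f n +
          U (n + 1) * ∑ i ∈ Finset.range n, U i * f (n - 1 - i) := by
          rw [← mul_add, ← e2]
        rw [e1]
        nlinarith
      exact pos_of_mul_pos_left this hn.le

theorem IsKaluza.renewalSurv_pos {U : ℕ → ℝ} (hU : IsKaluza U) (n : ℕ) :
    0 < renewalSurv U U n := by
  rcases n with _ | n
  · simp [renewalSurv]
  rw [renewalSurv_eq_one_sub_sum, sub_pos]
  set f := renewalExcl U U with hf
  have e2 : U n = f n + ∑ i ∈ Finset.range n, U i * f (n - 1 - i) := by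
    have := renewalExcl_eq U n U
    linarith
  -- Monotonicity turns the renewal equation into `U n * (1 - ∑ i < n, f i) ≥ f n`, and `f n > U n *
  -- f n`.
  have h1 : ∑ i ∈ Finset.range n, U n * f (n - 1 - i) ≤
      ∑ i ∈ Finset.range n, U i * f (n - 1 - i) := by
    refine Finset.sum_le_sum fun i hi => ?_
    have := hU.renewalExcl_pos (n - 1 - i)
    have := hU.anti (Finset.mem_range.1 hi).le
    gcongr
  rw [← Finset.mul_sum, Finset.sum_range_reflect] at h1
  rw [Finset.sum_range_succ]
  have h2 := hU.renewalExcl_pos n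
  have h3 := hU.lt_one n
  have h4 := hU.pos n
  rw [← hf] at h2
  by_contra! h
  nlinarith

theorem IsKaluza.renewalSurv_const_pos {U : ℕ → ℝ} (hU : IsKaluza U) {p : ℝ}
    (hp : ∀ n, p ≤ U n) (n : ℕ) : 0 < renewalSurv U (fun _ => p) n := by
  refine (hU.renewalSurv_pos n).trans_le ?_
  rw [renewalSurv_eq, renewalSurv_eq U n (fun _ => p)]
  gcongr with i hi
  · exact (hU.renewalSurv_pos _).le
  · exact hp i

/-! ### The generalized Bernoulli process as a renewal process -/

/-- The conditional probability that a generalized Bernoulli process has a `1` at time `n + 1`,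
given a `1` at time `0`. -/
noncomputable def gbpRenewal (p H c : ℝ) (n : ℕ) : ℝ := p + c * ((n : ℝ) + 1) ^ (2 * H - 2)

theorem isKaluza_gbpRenewal {p H c : ℝ} (hp : 0 < p) (hH : H < 1) (hc : 0 < c)
    (h1 : p + c < 1) (h2 : (p + c) ^ 2 < p + c * (2 : ℝ) ^ (2 * H - 2)) :
    IsKaluza (gbpRenewal p H c) := by
  have hanti : Antitone (gbpRenewal p H c) := by
    intro m n h
    unfold gbpRenewal
    have : ((n : ℝ) + 1) ^ (2 * H - 2) ≤ ((m : ℝ) + 1) ^ (2 * H - 2) :=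
      Real.rpow_le_rpow_of_nonpos (by positivity) (by gcongr) (by linarith)
    gcongr
  refine ⟨fun n => ?_, fun n => ?_, hanti, ?_, fun n => ?_⟩
  · unfold gbpRenewal; positivity
  · refine (hanti (Nat.zero_le n)).trans_lt ?_
    simpa [gbpRenewal] using h1
  · have : ((1 : ℕ) : ℝ) + 1 = 2 := by norm_num
    simpa only [gbpRenewal, this, Nat.cast_zero, zero_add, Real.one_rpow, mul_one] using h2
  · unfold gbpRenewal
    push_cast
    set x : ℝ := (n : ℝ) with hx
    have hx0 : 0 ≤ x := by positivity
    set a := (x + 1) ^ (2 * H - 2) with ha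
    set b := (x + 1 + 1) ^ (2 * H - 2) with hb
    set d := (x + 2 + 1) ^ (2 * H - 2) with hd
    have ha0 : 0 < a := by positivity
    have hb0 : 0 < b := by positivity
    have hd0 : 0 < d := by positivity
    -- The power term is log-convex; adding the constant `p` preserves this, since the cross terms
    -- only need `2 * b ≤ a + d`, which is the AM-GM inequality.
    have hbad : b ^ 2 ≤ a * d := by
      rw [ha, hb, hd, sq, ← Real.mul_rpow (by positivity) (by positivity),
        ← Real.mul_rpow (by positivity) (by positivity)]
      exact Real.rpow_le_rpow_of_nonpos (by positivity) (by nlinarith) (by linarith)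
    have h2b : 2 * b ≤ a + d := by
      nlinarith [sq_nonneg (a - d)]
    nlinarith [mul_pos hp hc, mul_pos hc hc]

/-- The probability of `1`s at all times `i₀ < i₁ < ⋯` of the list, where `v (i₀ - i - 1)` is the
probability of a `1` at the first of them. -/
noncomputable def gbpFrom (p H c : ℝ) (v : ℕ → ℝ) (i : ℕ) : List ℕ → ℝ
  | [] => 1
  | x :: l => v (x - i - 1) * gbpChain p H c (x :: l)

theorem gbpChain_cons_eq_gbpFrom (p H c : ℝ) (i : ℕ) (l : List ℕ) (hl : ∀ x ∈ l, i < x) :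
    gbpChain p H c (i :: l) = gbpFrom p H c (gbpRenewal p H c) i l := by
  rcases l with _ | ⟨x, l⟩
  · simp [gbpChain, gbpFrom]
  · have hx : i < x := hl x (by simp)
    have : |(x : ℝ) - i| = ((x - i - 1 : ℕ) : ℝ) + 1 := by
      rw [abs_of_pos (sub_pos.2 (by exact_mod_cast hx))]
      have : ((x - i - 1 : ℕ) : ℝ) + 1 = ((x - i - 1 + 1 : ℕ) : ℝ) := by push_cast; ring
      rw [this, show x - i - 1 + 1 = x - i by omega, Nat.cast_sub hx.le]
    rw [gbpChain, gbpFrom, this, gbpRenewal]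

theorem gbpFrom_sort_insert (p H c : ℝ) (v : ℕ → ℝ) (i : ℕ) (S : Finset ℕ)
    (hS : ∀ x ∈ S, i + 1 < x) :
    gbpFrom p H c v i ((insert (i + 1) S).sort (· ≤ ·)) =
      v 0 * gbpFrom p H c (gbpRenewal p H c) (i + 1) (S.sort (· ≤ ·)) := by
  rw [Finset.sort_insert (· ≤ ·) (fun b hb => (hS b hb).le) (fun h => lt_irrefl _ (hS _ h)),
    gbpFrom, gbpChain_cons_eq_gbpFrom]
  · simp
  · simpa using hS

theorem gbpFrom_sort_shift (p H c : ℝ) (v : ℕ → ℝ) (i : ℕ) (S : Finset ℕ)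
    (hS : ∀ x ∈ S, i + 1 < x) :
    gbpFrom p H c v i (S.sort (· ≤ ·)) =
      gbpFrom p H c (fun k => v (k + 1)) (i + 1) (S.sort (· ≤ ·)) := by
  have h : ∀ x ∈ S.sort (· ≤ ·), i + 1 < x := by simpa using hS
  generalize S.sort (· ≤ ·) = l at h ⊢
  rcases l with _ | ⟨x, l⟩
  · rfl
  · have hx := h x (by simp)
    rw [gbpFrom, gbpFrom, show x - (i + 1) - 1 + 1 = x - i - 1 by omega]

theorem gbpOnes_eq_gbpFrom (p H c : ℝ) (S : Finset ℕ) :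
    gbpOnes p H c S = gbpFrom p H c (fun _ => p) 0 (S.sort (· ≤ ·)) := by
  unfold gbpOnes
  split_ifs with h
  · simp [h, gbpFrom]
  · rcases hl : S.sort (· ≤ ·) with _ | ⟨x, l⟩
    · exact absurd (by simpa [hl] using (Finset.sort_toFinset S (· ≤ ·)).symm) h
    · rw [gbpFrom]

theorem Ioc_add_succ_eq_insert (i m : ℕ) :
    Finset.Ioc i (i + (m + 1)) = insert (i + 1) (Finset.Ioc (i + 1) (i + 1 + m)) := by
  ext x
  simp only [Finset.mem_insert, Finset.mem_Ioc]
  omega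

/-- The signed sum that gives the probability of the pattern on `(i, i + m]` with `1`s exactly
on `A`. -/
noncomputable def gbpPattern (p H c : ℝ) (A : Finset ℕ) (v : ℕ → ℝ) (i m : ℕ) : ℝ :=
  ∑ B ∈ (Finset.Ioc i (i + m) \ A).powerset,
    (-1 : ℝ) ^ B.card * gbpFrom p H c v i ((B ∪ (Finset.Ioc i (i + m) ∩ A)).sort (· ≤ ·))

theorem gbpPattern_zero (p H c : ℝ) (A : Finset ℕ) (v : ℕ → ℝ) (i : ℕ) :
    gbpPattern p H c A v i 0 = 1 := by
  simp [gbpPattern, gbpFrom]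

theorem gbpPattern_succ_of_mem (p H c : ℝ) (A : Finset ℕ) (v : ℕ → ℝ) (i m : ℕ)
    (h : i + 1 ∈ A) :
    gbpPattern p H c A v i (m + 1) = v 0 * gbpPattern p H c A (gbpRenewal p H c) (i + 1) m := by
  unfold gbpPattern
  rw [Ioc_add_succ_eq_insert, Finset.insert_sdiff_of_mem _ h, Finset.insert_inter_of_mem h,
    Finset.mul_sum]
  refine Finset.sum_congr rfl fun B hB => ?_
  rw [Finset.union_insert, gbpFrom_sort_insert]
  · ring
  · intro x hx
    rw [Finset.mem_powerset] at hB
    rcases Finset.mem_union.1 hx with hx | hx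
    · have := hB hx
      simp at this
      omega
    · simp at hx
      omega

theorem gbpPattern_succ_of_notMem (p H c : ℝ) (A : Finset ℕ) (v : ℕ → ℝ) (i m : ℕ)
    (h : i + 1 ∉ A) :
    gbpPattern p H c A v i (m + 1) = gbpPattern p H c A (fun k => v (k + 1)) (i + 1) m -
      v 0 * gbpPattern p H c A (gbpRenewal p H c) (i + 1) m := by
  unfold gbpPattern
  have hn : i + 1 ∉ Finset.Ioc (i + 1) (i + 1 + m) \ A := by simp
  rw [Ioc_add_succ_eq_insert, Finset.insert_sdiff_of_notMem _ h,
    Finset.insert_inter_of_notMem h, Finset.sum_powerset_insert hn, sub_eq_add_neg,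
    Finset.mul_sum, ← Finset.sum_neg_distrib]
  have key : ∀ B ∈ (Finset.Ioc (i + 1) (i + 1 + m) \ A).powerset,
      ∀ x ∈ B ∪ (Finset.Ioc (i + 1) (i + 1 + m) ∩ A), i + 1 < x := by
    intro B hB x hx
    rw [Finset.mem_powerset] at hB
    rcases Finset.mem_union.1 hx with hx | hx
    · have := hB hx
      simp at this
      omega
    · simp at hx
      omega
  congr 1
  · refine Finset.sum_congr rfl fun B hB => ?_
    rw [gbpFrom_sort_shift _ _ _ _ _ _ (key B hB)]
  · refine Finset.sum_congr rfl fun B hB => ?_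
    rw [Finset.insert_union, gbpFrom_sort_insert _ _ _ _ _ _ (key B hB),
      Finset.card_insert_of_notMem, pow_succ]
    · ring
    · exact fun hi => hn ((Finset.mem_powerset.1 hB) hi)

/-- The process renews at each `1`, so `v` matters only up to the first `1` of the pattern, at
distance `r`; `κ` is the probability of the rest. Since `κ` and `r` do not depend on `v`, the
induction hypothesis applies at once to the shifted `v` and to the renewal sequence. -/
theorem gbpPattern_eq (p H c : ℝ) (hU : IsKaluza (gbpRenewal p H c)) (A : Finset ℕ) (m i : ℕ) :
    (∃ κ > 0, ∃ r, ∀ v, gbpPattern p H c A v i m = κ * renewalExcl (gbpRenewal p H c) v r) ∨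
      ∃ r, ∀ v, gbpPattern p H c A v i m = renewalSurv (gbpRenewal p H c) v r := by
  induction m generalizing i with
  | zero => exact Or.inr ⟨0, fun v => by rw [gbpPattern_zero, renewalSurv]⟩
  | succ m ih =>
    by_cases h : i + 1 ∈ A
    · refine Or.inl ⟨gbpPattern p H c A (gbpRenewal p H c) (i + 1) m, ?_, 0, fun v => ?_⟩
      · rcases ih (i + 1) with ⟨κ, hκ, r, hr⟩ | ⟨r, hr⟩
        · rw [hr]
          exact mul_pos hκ (hU.renewalExcl_pos r)
        · rw [hr]
          exact hU.renewalSurv_pos r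
      · rw [gbpPattern_succ_of_mem _ _ _ _ _ _ _ h, renewalExcl, mul_comm]
    · rcases ih (i + 1) with ⟨κ, hκ, r, hr⟩ | ⟨r, hr⟩
      · refine Or.inl ⟨κ, hκ, r + 1, fun v => ?_⟩
        rw [gbpPattern_succ_of_notMem _ _ _ _ _ _ _ h, hr, hr, renewalExcl]
        ring
      · refine Or.inr ⟨r + 1, fun v => ?_⟩
        rw [gbpPattern_succ_of_notMem _ _ _ _ _ _ _ h, hr, hr, renewalSurv]

/-! ### Positivity of the probability mass function -/

theorem gbpProb_pos {p H c : ℝ} (hp : 0 < p) (hc : 0 ≤ c) (hU : IsKaluza (gbpRenewal p H c))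
    {N : ℕ} {A : Finset ℕ} (hA : A ⊆ Finset.Icc 1 N) :
    0 < gbpProb p H c A (Finset.Icc 1 N \ A) := by
  have hI : Finset.Icc 1 N = Finset.Ioc 0 (0 + N) := by
    ext x
    simp only [Finset.mem_Icc, Finset.mem_Ioc]
    omega
  have : gbpProb p H c A (Finset.Icc 1 N \ A) = gbpPattern p H c A (fun _ => p) 0 N := by
    unfold gbpProb gbpPattern
    rw [← hI, Finset.inter_eq_right.2 hA]
    simp only [gbpOnes_eq_gbpFrom]
  rw [this]
  rcases gbpPattern_eq p H c hU A N 0 with ⟨κ, hκ, r, hr⟩ | ⟨r, hr⟩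
  · rw [hr, renewalExcl_const]
    exact mul_pos hκ (mul_pos hp (hU.renewalSurv_pos r))
  · rw [hr]
    refine hU.renewalSurv_const_pos (fun n => ?_) r
    unfold gbpRenewal
    have : 0 ≤ c * ((n : ℝ) + 1) ^ (2 * H - 2) := by positivity
    linarith

theorem fbPmf_pos_of_isKaluza {p H c : ℝ} (hp : 0 < p) (hc : 0 ≤ c)
    (hU : IsKaluza (gbpRenewal p H c)) {N y : ℕ} (hy : y ≤ N) : 0 < fbPmf N p H c y := by
  refine Finset.sum_pos (fun A hA => gbpProb_pos hp hc hU (Finset.mem_powersetCard.1 hA).1) ?_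
  exact Finset.powersetCard_nonempty.2 (by simpa using hy)

theorem fbPmf_eq_zero (p H c : ℝ) {N y : ℕ} (hy : N < y) : fbPmf N p H c y = 0 := by
  unfold fbPmf
  rw [Finset.powersetCard_eq_empty.2 (by simpa using hy), Finset.sum_empty]

theorem fbCBound_eq (p H : ℝ) :
    fbCBound p H = min (1 - p) ((1 / 2) * (-2 * p + (2 : ℝ) ^ (2 * H - 2)
      + √(4 * p - p * (4 * (2 : ℝ) ^ (2 * H - 2)) + ((2 : ℝ) ^ (2 * H - 2)) ^ 2))) := by
  have e1 : (2 : ℝ) ^ (2 * H) = 4 * (2 : ℝ) ^ (2 * H - 2) := by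
    rw [Real.rpow_sub (by norm_num)]
    norm_num
    ring
  have e2 : (2 : ℝ) ^ (4 * H - 4) = ((2 : ℝ) ^ (2 * H - 2)) ^ 2 := by
    rw [← Real.rpow_natCast, ← Real.rpow_mul (by norm_num)]
    congr 1
    push_cast
    ring
  rw [fbCBound, e1, e2]

theorem fbCBound_pos {p H : ℝ} (hp : 0 < p) (hp1 : p < 1) : 0 < fbCBound p H := by
  rw [fbCBound_eq]
  refine lt_min (by linarith) ?_
  set q := (2 : ℝ) ^ (2 * H - 2) with hq
  -- The radicand is `(2 * p - q) ^ 2 + 4 * p * (1 - p)`.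
  have : 2 * p - q < √(4 * p - p * (4 * q) + q ^ 2) := by
    apply Real.lt_sqrt_of_sq_lt
    nlinarith [mul_pos hp (sub_pos.2 hp1)]
  linarith

/-- The second term of the minimum is the larger root in `c` of `(p + c) ^ 2 = p + c * 2 ^ (2 * H -
2)`, so lying below it means `U 0 ^ 2 < U 1`. -/
theorem isKaluza_of_lt_fbCBound {p H c : ℝ} (hp : 0 < p) (hp1 : p < 1) (hH1 : H < 1)
    (hc : 0 < c) (h : c < fbCBound p H) : IsKaluza (gbpRenewal p H c) := by
  rw [fbCBound_eq] at h
  obtain ⟨h1, h2⟩ := lt_min_iff.1 h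
  refine isKaluza_gbpRenewal hp hH1 hc (by linarith) ?_
  set q := (2 : ℝ) ^ (2 * H - 2) with hq
  by_cases hs : 0 ≤ 2 * c + 2 * p - q
  · have h3 : 2 * c + 2 * p - q < √(4 * p - p * (4 * q) + q ^ 2) := by linarith
    have := (Real.lt_sqrt hs).1 h3
    nlinarith
  · nlinarith [mul_pos hp (sub_pos.2 hp1), mul_pos hp hc]

theorem fbPmf_pos {p H c : ℝ} (hp : 0 < p) (hp1 : p < 1) (hH1 : H < 1)
    (hc : 0 < c) (h : c < fbCBound p H) {N y : ℕ} (hy : y ≤ N) : 0 < fbPmf N p H c y :=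
  fbPmf_pos_of_isKaluza hp hc.le (isKaluza_of_lt_fbCBound hp hp1 hH1 hc h) hy

/-! ### Binomial moments -/

/-- Möbius inversion on the subset lattice: after exchanging sums, the signs over the sets between
`R` and `S` cancel unless `S = R`. -/
theorem sum_gbpProb_superset (p H c : ℝ) {I R : Finset ℕ} (hR : R ⊆ I) :
    ∑ A ∈ I.powerset with R ⊆ A, gbpProb p H c A (I \ A) = gbpOnes p H c R := by
  have h1 : ∀ A ∈ I.powerset.filter (R ⊆ ·), gbpProb p H c A (I \ A) =
      ∑ S ∈ I.powerset with A ⊆ S, (-1 : ℝ) ^ (S \ A).card * gbpOnes p H c S := by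
    intro A hA
    have hAI : A ⊆ I := by
      have := (Finset.mem_filter.1 hA).1
      simpa using this
    unfold gbpProb
    refine Finset.sum_bij' (fun B _ => B ∪ A) (fun S _ => S \ A) ?_ ?_ ?_ ?_ ?_
    · intro B hB
      simp only [Finset.mem_powerset, Finset.mem_filter] at hB ⊢
      exact ⟨Finset.union_subset (hB.trans Finset.sdiff_subset) hAI, Finset.subset_union_right⟩
    · intro S hS
      simp only [Finset.mem_powerset, Finset.mem_filter] at hS ⊢
      exact Finset.sdiff_subset_sdiff hS.1 le_rfl
    · intro B hB
      simp only [Finset.mem_powerset] at hB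
      have : Disjoint B A := Finset.disjoint_of_subset_left hB Finset.sdiff_disjoint
      rw [Finset.union_sdiff_right, Finset.sdiff_eq_self_of_disjoint this]
    · intro S hS
      simp only [Finset.mem_powerset, Finset.mem_filter] at hS
      exact Finset.sdiff_union_of_subset hS.2
    · intro B hB
      simp only [Finset.mem_powerset] at hB
      have : Disjoint B A := Finset.disjoint_of_subset_left hB Finset.sdiff_disjoint
      rw [Finset.union_sdiff_right, Finset.sdiff_eq_self_of_disjoint this]
  rw [Finset.sum_congr rfl h1]
  rw [Finset.sum_comm' (t' := I.powerset.filter (R ⊆ ·))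
    (s' := fun S => S.powerset.filter (R ⊆ ·))]
  · have h2 : ∀ S ∈ I.powerset.filter (R ⊆ ·),
        ∑ A ∈ S.powerset with R ⊆ A, (-1 : ℝ) ^ (S \ A).card * gbpOnes p H c S =
          if S = R then gbpOnes p H c R else 0 := by
      intro S hS
      have hRS := (Finset.mem_filter.1 hS).2
      have h3 : ∑ A ∈ S.powerset with R ⊆ A, (-1 : ℝ) ^ (S \ A).card =
          ∑ B ∈ (S \ R).powerset, (-1 : ℝ) ^ B.card := by
        refine Finset.sum_bij' (fun A _ => S \ A) (fun B _ => S \ B) ?_ ?_ ?_ ?_ ?_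
        · intro A hA
          simp only [Finset.mem_powerset, Finset.mem_filter] at hA ⊢
          exact Finset.sdiff_subset_sdiff le_rfl hA.2
        · intro B hB
          simp only [Finset.mem_powerset, Finset.mem_filter] at hB ⊢
          refine ⟨Finset.sdiff_subset, fun x hx => ?_⟩
          rw [Finset.mem_sdiff]
          exact ⟨hRS hx, fun h => (Finset.mem_sdiff.1 (hB h)).2 hx⟩
        · intro A hA
          simp only [Finset.mem_powerset, Finset.mem_filter] at hA
          exact Finset.sdiff_sdiff_eq_self hA.1
        · intro B hB
          simp only [Finset.mem_powerset] at hB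
          exact Finset.sdiff_sdiff_eq_self (hB.trans Finset.sdiff_subset)
        · intro A hA
          rfl
      rw [← Finset.sum_mul, h3]
      split_ifs with h
      · subst h
        simp
      · have hne : (S \ R).Nonempty :=
          Finset.sdiff_nonempty.2 fun h' => h (Finset.Subset.antisymm h' hRS)
        have := Finset.sum_powerset_neg_one_pow_card_of_nonempty hne
        have h4 : ∑ B ∈ (S \ R).powerset, (-1 : ℝ) ^ B.card = 0 := by exact_mod_cast this
        rw [h4, zero_mul]
    rw [Finset.sum_congr rfl h2, Finset.sum_ite_eq', if_pos]
    simpa using hR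
  · intro A S
    simp only [Finset.mem_powerset, Finset.mem_filter]
    constructor
    · rintro ⟨⟨_, h2⟩, h3, h4⟩
      exact ⟨⟨h4, h2⟩, h3, h2.trans h4⟩
    · rintro ⟨⟨h1, h2⟩, h3, h4⟩
      exact ⟨⟨h1.trans h3, h2⟩, h3, h1⟩

/-- The binomial moments of the fractional binomial distribution. -/
theorem sum_choose_mul_fbPmf (p H c : ℝ) (N r : ℕ) :
    ∑ y ∈ Finset.range (N + 1), (y.choose r : ℝ) * fbPmf N p H c y =
      ∑ R ∈ (Finset.Icc 1 N).powersetCard r, gbpOnes p H c R := by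
  set I := Finset.Icc 1 N with hI
  have hcard : I.card = N := by simp [hI]
  have h1 : ∑ y ∈ Finset.range (N + 1), (y.choose r : ℝ) * fbPmf N p H c y =
      ∑ A ∈ I.powerset, (A.card.choose r : ℝ) * gbpProb p H c A (I \ A) := by
    rw [Finset.sum_powerset, hcard]
    refine Finset.sum_congr rfl fun y _ => ?_
    unfold fbPmf
    rw [Finset.mul_sum]
    refine Finset.sum_congr rfl fun A hA => ?_
    rw [(Finset.mem_powersetCard.1 hA).2]
  rw [h1]
  have h2 : ∀ R ∈ I.powersetCard r, gbpOnes p H c R =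
      ∑ A ∈ I.powerset with R ⊆ A, gbpProb p H c A (I \ A) := fun R hR =>
    (sum_gbpProb_superset p H c (Finset.mem_powersetCard.1 hR).1).symm
  rw [Finset.sum_congr rfl h2, Finset.sum_comm' (t' := I.powerset)
    (s' := fun A => A.powersetCard r)]
  · refine Finset.sum_congr rfl fun A _ => ?_
    rw [Finset.sum_const, Finset.card_powersetCard, nsmul_eq_mul]
  · intro R A
    simp only [Finset.mem_powerset, Finset.mem_filter, Finset.mem_powersetCard]
    constructor
    · rintro ⟨⟨_, h2⟩, h3, h4⟩
      exact ⟨⟨h4, h2⟩, h3⟩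
    · rintro ⟨⟨h1, h2⟩, h3⟩
      exact ⟨⟨h1.trans h3, h2⟩, h3, h1⟩

theorem sum_fbPmf (p H c : ℝ) (N : ℕ) : ∑ y ∈ Finset.range (N + 1), fbPmf N p H c y = 1 := by
  have := sum_choose_mul_fbPmf p H c N 0
  simpa [gbpOnes] using this

/-- The sets are sorted by their smallest element `i + k + 1`, where the process renews. -/
theorem sum_powersetCard_gbpFrom (p H c : ℝ) (r m : ℕ) (v : ℕ → ℝ) (i : ℕ) :
    ∑ S ∈ (Finset.Ioc i (i + m)).powersetCard (r + 1), gbpFrom p H c v i (S.sort (· ≤ ·)) =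
      ∑ k ∈ Finset.range m, v k *
        ∑ S ∈ (Finset.Ioc (i + k + 1) (i + m)).powersetCard r,
          gbpFrom p H c (gbpRenewal p H c) (i + k + 1) (S.sort (· ≤ ·)) := by
  induction m generalizing v i with
  | zero =>
    have : Finset.powersetCard (r + 1) (∅ : Finset ℕ) = ∅ := by
      rw [Finset.powersetCard_eq_empty]
      simp
    simp [this]
  | succ m ih =>
    have hn : i + 1 ∉ Finset.Ioc (i + 1) (i + 1 + m) := by simp
    have key : ∀ q, ∀ S ∈ (Finset.Ioc (i + 1) (i + 1 + m)).powersetCard q,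
        ∀ x ∈ S, i + 1 < x := fun q S hS x hx =>
      (Finset.mem_Ioc.1 ((Finset.mem_powersetCard.1 hS).1 hx)).1
    rw [Ioc_add_succ_eq_insert, Finset.powersetCard_succ_insert hn, Finset.sum_union,
      Finset.sum_image, Finset.sum_range_succ']
    · congr 1
      · rw [Finset.sum_congr rfl fun S hS => gbpFrom_sort_shift p H c v i S (key _ S hS), ih]
        refine Finset.sum_congr rfl fun k _ => ?_
        rw [show i + 1 + k + 1 = i + (k + 1) + 1 by ring, show i + 1 + m = i + (m + 1) by ring]
      · rw [Finset.sum_congr rfl fun S hS => gbpFrom_sort_insert p H c v i S (key _ S hS),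
          ← Finset.mul_sum, show i + 1 + m = i + (m + 1) by ring, add_zero]
    · intro S hS T hT hST
      have h1 : i + 1 ∉ S := fun h => lt_irrefl _ (key _ S hS _ h)
      have h2 : i + 1 ∉ T := fun h => lt_irrefl _ (key _ T hT _ h)
      rw [← Finset.erase_insert h1, ← Finset.erase_insert h2]
      exact congrArg (fun s => Finset.erase s (i + 1)) hST
    · rw [Finset.disjoint_left]
      intro S hS hS'
      obtain ⟨T, _, rfl⟩ := Finset.mem_image.1 hS'
      exact lt_irrefl _ (key _ _ hS (i + 1) (Finset.mem_insert_self _ _))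

/-- The sum, over all sets of `r` times in `[0, m)`, of the probability that all of them are
renewal times. -/
def renewalMoment (U : ℕ → ℝ) : ℕ → (ℕ → ℝ) → ℕ → ℝ
  | 0, _, _ => 1
  | r + 1, v, m => ∑ k ∈ Finset.range m, v k * renewalMoment U r U (m - 1 - k)

theorem sum_powersetCard_gbpFrom_eq (p H c : ℝ) (r m : ℕ) (v : ℕ → ℝ) (i : ℕ) :
    ∑ S ∈ (Finset.Ioc i (i + m)).powersetCard r, gbpFrom p H c v i (S.sort (· ≤ ·)) =
      renewalMoment (gbpRenewal p H c) r v m := by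
  induction r generalizing m v i with
  | zero => simp [renewalMoment, gbpFrom]
  | succ r ih =>
    rw [sum_powersetCard_gbpFrom, renewalMoment]
    refine Finset.sum_congr rfl fun k hk => ?_
    have := Finset.mem_range.1 hk
    rw [show i + m = i + k + 1 + (m - 1 - k) by omega, ih]

theorem sum_choose_mul_fbPmf_eq (p H c : ℝ) (N r : ℕ) :
    ∑ y ∈ Finset.range (N + 1), (y.choose r : ℝ) * fbPmf N p H c y =
      renewalMoment (gbpRenewal p H c) r (fun _ => p) N := by
  have hI : Finset.Icc 1 N = Finset.Ioc 0 (0 + N) := by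
    ext x
    simp only [Finset.mem_Icc, Finset.mem_Ioc]
    omega
  rw [sum_choose_mul_fbPmf, hI, ← sum_powersetCard_gbpFrom_eq p H c r N (fun _ => p) 0]
  simp only [gbpOnes_eq_gbpFrom]

/-! ### Identifiability from the first three moments -/

theorem sum_range_sum_conv (a b : ℕ → ℝ) (n : ℕ) :
    ∑ k ∈ Finset.range n, ∑ l ∈ Finset.range k, a l * b (k - 1 - l) =
      ∑ l ∈ Finset.range n, a l * ∑ j ∈ Finset.range (n - 1 - l), b j := by
  induction n with
  | zero => simp
  | succ n ih =>
    rw [Finset.sum_range_succ, ih, Finset.sum_range_succ _ n]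
    simp only [Nat.add_sub_cancel, Nat.sub_self, Finset.range_zero, Finset.sum_empty, mul_zero,
      add_zero]
    rw [← Finset.sum_add_distrib]
    refine Finset.sum_congr rfl fun l hl => ?_
    have := Finset.mem_range.1 hl
    rw [show n - l = n - 1 - l + 1 by omega, Finset.sum_range_succ, mul_add]

theorem sum_range_sum_range (a : ℕ → ℝ) (n : ℕ) :
    ∑ k ∈ Finset.range n, ∑ l ∈ Finset.range k, a l =
      ∑ l ∈ Finset.range n, ((n - 1 - l : ℕ) : ℝ) * a l := by
  have := sum_range_sum_conv a (fun _ => 1) n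
  simpa [mul_comm] using this

theorem renewalMoment_one (U : ℕ → ℝ) (v : ℕ → ℝ) (N : ℕ) :
    renewalMoment U 1 v N = ∑ k ∈ Finset.range N, v k := by
  simp [renewalMoment]

theorem renewalMoment_succ_const (U : ℕ → ℝ) (p : ℝ) (r N : ℕ) :
    renewalMoment U (r + 1) (fun _ => p) N =
      p * ∑ k ∈ Finset.range N, renewalMoment U r U k := by
  rw [renewalMoment, ← Finset.mul_sum, Finset.sum_range_reflect]

theorem renewalMoment_two_const (U : ℕ → ℝ) (p : ℝ) (N : ℕ) :
    renewalMoment U 2 (fun _ => p) N =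
      p * ∑ l ∈ Finset.range N, ((N - 1 - l : ℕ) : ℝ) * U l := by
  rw [renewalMoment_succ_const]
  simp only [renewalMoment_one, sum_range_sum_range]

theorem renewalMoment_three_const (U : ℕ → ℝ) (p : ℝ) (N : ℕ) :
    renewalMoment U 3 (fun _ => p) N =
      p * ∑ l ∈ Finset.range N, U l *
        ∑ j ∈ Finset.range (N - 1 - l), ∑ i ∈ Finset.range j, U i := by
  rw [renewalMoment_succ_const, ← sum_range_sum_conv U (fun j => ∑ i ∈ Finset.range j, U i)]
  simp only [renewalMoment, mul_one]

/-- The third moment is a bilinear form with the symmetric kernel `N - 2 - l - i` (truncated at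
zero), so a difference of its values at `V` and `V'` is its value at `V - V'` and `V + V'`. -/
theorem sum_mul_sum_sum_comm (a b : ℕ → ℝ) (N : ℕ) :
    ∑ l ∈ Finset.range N, a l * ∑ j ∈ Finset.range (N - 1 - l), ∑ i ∈ Finset.range j, b i =
      ∑ l ∈ Finset.range N, b l * ∑ j ∈ Finset.range (N - 1 - l), ∑ i ∈ Finset.range j, a i := by
  have key : ∀ a b : ℕ → ℝ,
      ∑ l ∈ Finset.range N, a l * ∑ j ∈ Finset.range (N - 1 - l), ∑ i ∈ Finset.range j, b i =
        ∑ l ∈ Finset.range N, ∑ i ∈ Finset.range N,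
          ((N - 2 - l - i : ℕ) : ℝ) * (a l * b i) := by
    intro a b
    refine Finset.sum_congr rfl fun l hl => ?_
    rw [sum_range_sum_range, Finset.mul_sum]
    have hsub : Finset.range (N - 1 - l) ⊆ Finset.range N := by
      intro x
      simp only [Finset.mem_range]
      omega
    rw [← Finset.sum_subset hsub]
    · refine Finset.sum_congr rfl fun i _ => ?_
      rw [show N - 1 - l - 1 - i = N - 2 - l - i by omega]
      ring
    · intro i _ hi
      rw [Finset.mem_range, not_lt] at hi
      rw [show N - 2 - l - i = 0 by omega]
      simp
  rw [key a b, key b a, Finset.sum_comm]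
  refine Finset.sum_congr rfl fun l _ => Finset.sum_congr rfl fun i _ => ?_
  rw [show N - 2 - i - l = N - 2 - l - i by omega]
  ring

theorem strictMono_average {q : ℕ → ℝ} (hq : StrictMono q) :
    StrictMono fun n : ℕ => (∑ j ∈ Finset.range (n + 1), q j) / ((n : ℝ) + 1) := by
  refine strictMono_nat_of_lt_succ fun n => ?_
  have h : ∑ j ∈ Finset.range (n + 1), q j < ((n : ℝ) + 1) * q (n + 1) := by
    have : ∑ j ∈ Finset.range (n + 1), q j < ∑ j ∈ Finset.range (n + 1), q (n + 1) :=
      Finset.sum_lt_sum_of_nonempty (by simp) fun j hj => hq (Finset.mem_range.1 hj)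
    simpa using this
  rw [Finset.sum_range_succ _ (n + 1)]
  push_cast
  rw [div_lt_div_iff₀ (by positivity) (by positivity)]
  nlinarith

/-- If `δ` changes sign once, from `+` to `-`, and has mean zero for positive weights, then it
correlates positively with each strictly decreasing function. -/
theorem sum_mul_pos_of_single_crossing {M : ℕ} (hM : 1 ≤ M) {w δ h : ℕ → ℝ}
    (hw : ∀ l ≤ M, 0 < w l) (hδ : ∀ l l', l < l' → l' ≤ M → 0 ≤ δ l' → 0 < δ l)
    (hh : ∀ l l', l < l' → l' ≤ M → h l' < h l)
    (h0 : ∑ l ∈ Finset.range (M + 1), w l * δ l = 0) :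
    0 < ∑ l ∈ Finset.range (M + 1), w l * δ l * h l := by
  have hex : ∃ l, l ≤ M ∧ 0 ≤ δ l := by
    by_contra! hcon
    have : ∑ l ∈ Finset.range (M + 1), w l * δ l < 0 :=
      Finset.sum_neg (fun l hl => by
        have hl' : l ≤ M := Nat.lt_succ_iff.1 (Finset.mem_range.1 hl)
        exact mul_neg_of_pos_of_neg (hw l hl') (hcon l hl')) (by simp)
    linarith
  classical
  obtain ⟨l₀, hl₀, hδl₀⟩ := hex
  set d := Nat.findGreatest (fun l => 0 ≤ δ l) M with hd
  have hdM : d ≤ M := Nat.findGreatest_le M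
  have hδd : 0 ≤ δ d := Nat.findGreatest_spec (P := fun l => 0 ≤ δ l) hl₀ hδl₀
  have hgt : ∀ l, d < l → l ≤ M → δ l < 0 := fun l h1 h2 =>
    not_le.1 (Nat.findGreatest_is_greatest (P := fun l => 0 ≤ δ l) h1 h2)
  -- Mean zero allows `h` to be centred at the last index `d` with `0 ≤ δ d`; then `δ l` and `h l -
  -- h d` have the same sign on either side of `d`.
  have heq : ∑ l ∈ Finset.range (M + 1), w l * δ l * h l =
      ∑ l ∈ Finset.range (M + 1), w l * δ l * (h l - h d) := by
    simp only [mul_sub, Finset.sum_sub_distrib]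
    rw [← Finset.sum_mul, h0]
    ring
  have hlt : ∀ l, l < d → 0 < w l * δ l * (h l - h d) := fun l hl =>
    mul_pos (mul_pos (hw l (hl.le.trans hdM)) (hδ l d hl hdM hδd))
      (sub_pos.2 (hh l d hl hdM))
  have hgt' : ∀ l, d < l → l ≤ M → 0 < w l * δ l * (h l - h d) := fun l hl hlM =>
    mul_pos_of_neg_of_neg (mul_neg_of_pos_of_neg (hw l hlM) (hgt l hl hlM))
      (sub_neg.2 (hh d l hl hlM))
  rw [heq]
  refine Finset.sum_pos' (fun l hl => ?_) ?_
  · rcases lt_trichotomy l d with h1 | h1 | h1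
    · exact (hlt l h1).le
    · simp [h1]
    · exact (hgt' l h1 (Nat.lt_succ_iff.1 (Finset.mem_range.1 hl))).le
  · rcases Nat.eq_zero_or_pos d with h1 | h1
    -- A strictly positive term needs an index other than `d`, which `1 ≤ M` provides.
    · exact ⟨1, by simp; omega, hgt' 1 (by omega) hM⟩
    · exact ⟨0, by simp, hlt 0 h1⟩

/-- With weights `M + 1 - l`, equal second moments say that `V - V'` has mean zero. The difference
of third moments is the correlation of `V - V'` with averages of the increasing partial sums of `V +
V'`; these averages decrease in `l`. -/
theorem third_moment_lt {M : ℕ} (hM : 1 ≤ M) {V V' : ℕ → ℝ} (hV : ∀ l, 0 < V l)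
    (hV' : ∀ l, 0 < V' l) (hδ : ∀ l l', l < l' → V' l' ≤ V l' → V' l < V l)
    (h2 : ∑ l ∈ Finset.range (M + 2), ((M + 2 - 1 - l : ℕ) : ℝ) * V l =
      ∑ l ∈ Finset.range (M + 2), ((M + 2 - 1 - l : ℕ) : ℝ) * V' l) :
    ∑ l ∈ Finset.range (M + 2), V' l *
        ∑ j ∈ Finset.range (M + 2 - 1 - l), ∑ i ∈ Finset.range j, V' i <
      ∑ l ∈ Finset.range (M + 2), V l *
        ∑ j ∈ Finset.range (M + 2 - 1 - l), ∑ i ∈ Finset.range j, V i := by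
  set q : ℕ → ℝ := fun j => ∑ i ∈ Finset.range j, (V i + V' i) with hq
  have hqm : StrictMono q := strictMono_nat_of_lt_succ fun n => by
    simp only [hq, Finset.sum_range_succ _ n]
    linarith [hV n, hV' n]
  have hg := strictMono_average hqm
  have key := sum_mul_pos_of_single_crossing hM (w := fun l => ((M + 2 - 1 - l : ℕ) : ℝ))
    (δ := fun l => V l - V' l)
    (h := fun l => (∑ j ∈ Finset.range (M - l + 1), q j) / (((M - l : ℕ) : ℝ) + 1))
    (fun l hl => by
      have : 0 < M + 2 - 1 - l := by omega
      exact_mod_cast this)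
    (fun l l' h h' h'' => sub_pos.2 (hδ l l' h (sub_nonneg.1 h'')))
    (fun l l' h h' => hg (show M - l' < M - l by omega))
    (by
      rw [Finset.sum_range_succ _ (M + 1), Finset.sum_range_succ _ (M + 1)] at h2
      simp only [mul_sub, Finset.sum_sub_distrib]
      simpa [sub_eq_zero] using h2)
  have e1 : ∑ l ∈ Finset.range (M + 1), ((M + 2 - 1 - l : ℕ) : ℝ) * (V l - V' l) *
      ((∑ j ∈ Finset.range (M - l + 1), q j) / (((M - l : ℕ) : ℝ) + 1)) =
      ∑ l ∈ Finset.range (M + 2), (V l - V' l) * ∑ j ∈ Finset.range (M + 2 - 1 - l), q j := by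
    rw [Finset.sum_range_succ _ (M + 1)]
    simp only [show M + 2 - 1 - (M + 1) = 0 by omega, Finset.range_zero, Finset.sum_empty,
      mul_zero, add_zero]
    refine Finset.sum_congr rfl fun l hl => ?_
    have := Finset.mem_range.1 hl
    rw [show M + 2 - 1 - l = M - l + 1 by omega]
    push_cast
    field_simp
  have e2 : ∑ l ∈ Finset.range (M + 2), (V l - V' l) * ∑ j ∈ Finset.range (M + 2 - 1 - l), q j =
      ∑ l ∈ Finset.range (M + 2), V l *
        ∑ j ∈ Finset.range (M + 2 - 1 - l), ∑ i ∈ Finset.range j, V i -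
      ∑ l ∈ Finset.range (M + 2), V' l *
        ∑ j ∈ Finset.range (M + 2 - 1 - l), ∑ i ∈ Finset.range j, V' i := by
    have hcomm := sum_mul_sum_sum_comm V V' (M + 2)
    simp only [hq, Finset.sum_add_distrib, sub_mul, mul_add, Finset.sum_sub_distrib]
    linarith
  rw [e1, e2] at key
  linarith

/-- The quotient of the two power terms is proportional to `(n + 1) ^ (2 * (H' - H))`, which is
strictly increasing. -/
theorem gbpRenewal_crossing {p H H' c c' : ℝ} (hc' : 0 < c') (hH : H < H') {l l' : ℕ}
    (hl : l < l') (h : gbpRenewal p H' c' l' ≤ gbpRenewal p H c l') :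
    gbpRenewal p H' c' l < gbpRenewal p H c l := by
  have key : ∀ n : ℕ, c' * ((n : ℝ) + 1) ^ (2 * H' - 2) =
      c' * ((n : ℝ) + 1) ^ (2 * (H' - H)) * ((n : ℝ) + 1) ^ (2 * H - 2) := by
    intro n
    rw [mul_assoc, ← Real.rpow_add (by positivity)]
    congr 2
    ring
  unfold gbpRenewal at *
  rw [key] at h ⊢
  have h1 : c' * ((l' : ℝ) + 1) ^ (2 * (H' - H)) ≤ c :=
    le_of_mul_le_mul_right (by linarith) (show 0 < ((l' : ℝ) + 1) ^ (2 * H - 2) by positivity)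
  have h2 : ((l : ℝ) + 1) ^ (2 * (H' - H)) < ((l' : ℝ) + 1) ^ (2 * (H' - H)) :=
    Real.rpow_lt_rpow (by positivity) (by gcongr) (by linarith)
  have h3 : c' * ((l : ℝ) + 1) ^ (2 * (H' - H)) < c := lt_of_lt_of_le (by gcongr) h1
  gcongr

theorem renewalMoment_ne_of_lt {N : ℕ} (hN : 3 ≤ N) {p H H' c c' : ℝ} (hp : 0 < p)
    (hc : 0 < c) (hc' : 0 < c') (hH : H < H')
    (h2 : renewalMoment (gbpRenewal p H c) 2 (fun _ => p) N =
      renewalMoment (gbpRenewal p H' c') 2 (fun _ => p) N) :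
    renewalMoment (gbpRenewal p H c) 3 (fun _ => p) N ≠
      renewalMoment (gbpRenewal p H' c') 3 (fun _ => p) N := by
  obtain ⟨M, rfl⟩ : ∃ M, N = M + 2 := ⟨N - 2, by omega⟩
  rw [renewalMoment_two_const, renewalMoment_two_const] at h2
  rw [renewalMoment_three_const, renewalMoment_three_const]
  have := third_moment_lt (M := M) (by omega) (V := gbpRenewal p H c)
    (V' := gbpRenewal p H' c') (fun l => by unfold gbpRenewal; positivity)
    (fun l => by unfold gbpRenewal; positivity)
    (fun l l' hl h => gbpRenewal_crossing hc' hH hl h) (mul_left_cancel₀ hp.ne' h2)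
  exact fun h => this.ne' (mul_left_cancel₀ hp.ne' h)

/-- The parameters of a fractional binomial distribution are determined by the distribution. -/
theorem fbPmf_injective {N : ℕ} (hN : 3 ≤ N) {p p' H H' c c' : ℝ} (hp : 0 < p)
    (hc : 0 < c) (hc' : 0 < c')
    (h : ∀ y ≤ N, fbPmf N p H c y = fbPmf N p' H' c' y) : p = p' ∧ H = H' ∧ c = c' := by
  have hm : ∀ r, renewalMoment (gbpRenewal p H c) r (fun _ => p) N =
      renewalMoment (gbpRenewal p' H' c') r (fun _ => p') N := by
    intro r
    rw [← sum_choose_mul_fbPmf_eq, ← sum_choose_mul_fbPmf_eq]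
    refine Finset.sum_congr rfl fun y hy => ?_
    rw [h y (Nat.lt_succ_iff.1 (Finset.mem_range.1 hy))]
  have hpp : p = p' := by
    have := hm 1
    simp only [renewalMoment_one, Finset.sum_const, Finset.card_range, nsmul_eq_mul] at this
    exact mul_left_cancel₀ (by positivity) this
  subst hpp
  have hHH : H = H' := by
    rcases lt_trichotomy H H' with hlt | heq | hlt
    · exact absurd (hm 3) (renewalMoment_ne_of_lt hN hp hc hc' hlt (hm 2))
    · exact heq
    · exact absurd (hm 3).symm (renewalMoment_ne_of_lt hN hp hc' hc hlt (hm 2).symm)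
  subst hHH
  refine ⟨rfl, rfl, ?_⟩
  have h2 := hm 2
  rw [renewalMoment_two_const, renewalMoment_two_const] at h2
  have h3 := mul_left_cancel₀ hp.ne' h2
  simp only [gbpRenewal, mul_add, Finset.sum_add_distrib, add_right_inj] at h3
  simp only [mul_left_comm _ c, mul_left_comm _ c', ← Finset.mul_sum] at h3
  refine mul_right_cancel₀ (ne_of_gt ?_) h3
  refine Finset.sum_pos' (fun l _ => by positivity) ⟨0, by simp; omega, ?_⟩
  have : 0 < N - 1 - 0 := by omega
  have : (0 : ℝ) < ((N - 1 - 0 : ℕ) : ℝ) := by exact_mod_cast this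
  positivity

/-! ### Continuity and identifiability of the regression model -/

/-- Distinct entries keep the base of the power away from `0`, where `0 ^ s` jumps at `s = 0`. -/
theorem continuous_gbpChain {T : Type*} [TopologicalSpace T] {p H c : T → ℝ}
    (hp : Continuous p) (hH : Continuous H) (hc : Continuous c) (l : List ℕ) (hl : l.Nodup) :
    Continuous fun t => gbpChain (p t) (H t) (c t) l := by
  induction l with
  | nil => simpa [gbpChain] using continuous_const
  | cons i l ih =>
    rcases l with _ | ⟨j, l⟩
    · simpa [gbpChain] using continuous_const
    · simp only [gbpChain]
      have hij : (j : ℝ) - i ≠ 0 := by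
        rw [sub_ne_zero]
        rintro h
        simp [Nat.cast_injective h] at hl
      have hr : Continuous fun t => |(j : ℝ) - i| ^ (2 * H t - 2) :=
        continuous_const.rpow (by fun_prop) fun t => Or.inl (abs_ne_zero.2 hij)
      have := ih (List.nodup_cons.1 hl).2
      fun_prop

theorem continuous_fbPmf {T : Type*} [TopologicalSpace T] {p H c : T → ℝ}
    (hp : Continuous p) (hH : Continuous H) (hc : Continuous c) (N y : ℕ) :
    Continuous fun t => fbPmf N (p t) (H t) (c t) y := by
  have hones : ∀ A : Finset ℕ, Continuous fun t => gbpOnes (p t) (H t) (c t) A := by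
    intro A
    unfold gbpOnes
    split_ifs
    · exact continuous_const
    · exact hp.mul (continuous_gbpChain hp hH hc _ (Finset.sort_nodup _ _))
  unfold fbPmf gbpProb
  fun_prop

theorem continuous_fbCBound {T : Type*} [TopologicalSpace T] {p H : T → ℝ}
    (hp : Continuous p) (hH : Continuous H) : Continuous fun t => fbCBound (p t) (H t) := by
  have hr : ∀ {f : T → ℝ}, Continuous f → Continuous fun t => (2 : ℝ) ^ f t := fun hf =>
    continuous_const.rpow hf fun t => Or.inl (by norm_num)
  have h1 := hr (f := fun t => 2 * H t - 2) (by fun_prop)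
  have h2 := hr (f := fun t => 2 * H t) (by fun_prop)
  have h3 := hr (f := fun t => 4 * H t - 4) (by fun_prop)
  unfold fbCBound
  fun_prop

theorem continuous_invLogit : Continuous invLogit := by
  unfold invLogit
  refine continuous_const.div (by fun_prop) fun t => ?_
  positivity

theorem invLogit_pos (t : ℝ) : 0 < invLogit t := by
  unfold invLogit
  positivity

theorem invLogit_lt_one (t : ℝ) : invLogit t < 1 := by
  unfold invLogit
  rw [div_lt_one (by positivity)]
  linarith [Real.exp_pos (-t)]

theorem invLogit_injective : Function.Injective invLogit := by
  intro s t h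
  unfold invLogit at h
  rw [div_eq_div_iff (by positivity) (by positivity)] at h
  have : Real.exp (-t) = Real.exp (-s) := by linarith
  linarith [Real.exp_injective this]

theorem continuous_linPred {k : ℕ} :
    Continuous fun z : (Fin (k + 1) → ℝ) × (Fin k → ℝ) => linPred z.1 z.2 := by
  unfold linPred
  fun_prop

theorem continuous_fbRegPmf {k : ℕ} (N y : ℕ) :
    Continuous fun z : FBParam k × (Fin k → ℝ) => fbRegPmf N z.1 z.2 y := by
  have hp : Continuous fun z : FBParam k × (Fin k → ℝ) => invLogit (linPred z.1.1 z.2) :=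
    continuous_invLogit.comp (continuous_linPred.comp (by fun_prop :
      Continuous fun z : FBParam k × (Fin k → ℝ) => (z.1.1, z.2)))
  have hH : Continuous fun z : FBParam k × (Fin k → ℝ) => invLogit (linPred z.1.2.1 z.2) :=
    continuous_invLogit.comp (continuous_linPred.comp (by fun_prop :
      Continuous fun z : FBParam k × (Fin k → ℝ) => (z.1.2.1, z.2)))
  have hc : Continuous fun z : FBParam k × (Fin k → ℝ) => invLogit (linPred z.1.2.2 z.2) :=
    continuous_invLogit.comp (continuous_linPred.comp (by fun_prop :
      Continuous fun z : FBParam k × (Fin k → ℝ) => (z.1.2.2, z.2)))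
  exact continuous_fbPmf hp hH (hc.mul (continuous_fbCBound hp hH)) N y

theorem fbRegPmf_pos {k N y : ℕ} (hy : y ≤ N) (Θ : FBParam k) (x : Fin k → ℝ) :
    0 < fbRegPmf N Θ x y := by
  have hm := fbCBound_pos (H := invLogit (linPred Θ.2.1 x)) (invLogit_pos (linPred Θ.1 x))
    (invLogit_lt_one _)
  refine fbPmf_pos (invLogit_pos _) (invLogit_lt_one _) (invLogit_lt_one _)
    (mul_pos (invLogit_pos _) hm) ?_ hy
  exact mul_lt_of_lt_one_left hm (invLogit_lt_one _)

theorem fbRegPmf_eq_zero {k N y : ℕ} (hy : N < y) (Θ : FBParam k) (x : Fin k → ℝ) :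
    fbRegPmf N Θ x y = 0 :=
  fbPmf_eq_zero _ _ _ hy

theorem continuous_log_fbRegPmf {k : ℕ} (N y : ℕ) :
    Continuous fun z : FBParam k × (Fin k → ℝ) => Real.log (fbRegPmf N z.1 z.2 y) := by
  by_cases hy : y ≤ N
  · exact (continuous_fbRegPmf N y).log fun z => (fbRegPmf_pos hy _ _).ne'
  -- Beyond `N` the logarithm takes its default value `Real.log 0 = 0`, so continuity is free there.
  · simp only [fbRegPmf_eq_zero (not_le.1 hy)]
    exact continuous_const

theorem linPred_eq_of_fbRegPmf_eq {k N : ℕ} (hN : 3 ≤ N) {Θ Θ' : FBParam k} {x : Fin k → ℝ}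
    (h : ∀ y ≤ N, fbRegPmf N Θ x y = fbRegPmf N Θ' x y) :
    linPred Θ.1 x = linPred Θ'.1 x ∧ linPred Θ.2.1 x = linPred Θ'.2.1 x ∧
      linPred Θ.2.2 x = linPred Θ'.2.2 x := by
  have hm : ∀ Θ : FBParam k,
      0 < fbCBound (invLogit (linPred Θ.1 x)) (invLogit (linPred Θ.2.1 x)) := fun Θ =>
    fbCBound_pos (invLogit_pos _) (invLogit_lt_one _)
  obtain ⟨h1, h2, h3⟩ := fbPmf_injective hN (invLogit_pos _)
    (mul_pos (invLogit_pos _) (hm Θ)) (mul_pos (invLogit_pos _) (hm Θ')) h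
  refine ⟨invLogit_injective h1, invLogit_injective h2, ?_⟩
  rw [← h1, ← h2] at h3
  exact invLogit_injective (mul_right_cancel₀ (hm Θ).ne' h3)

/-- Otherwise the difference of the slopes gives a nontrivial linear combination of covariates that
is almost surely constant. Once the slopes agree, a single point fixes the intercept. -/
theorem eq_of_linPred_ae_eq {k : ℕ} {g : Measure (Fin k → ℝ)} [IsProbabilityMeasure g]
    (hvar : ∀ a : Fin k → ℝ, a ≠ 0 → variance (fun x : Fin k → ℝ => ∑ j, a j * x j) g ≠ 0)
    {β β' : Fin (k + 1) → ℝ} (h : ∀ᵐ x ∂g, linPred β x = linPred β' x) : β = β' := by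
  have hd : ∀ᵐ x ∂g, ∑ j : Fin k, (β j.succ - β' j.succ) * x j = β' 0 - β 0 := by
    filter_upwards [h] with x hx
    unfold linPred at hx
    simp only [mul_comm _ (x _), mul_sub, Finset.sum_sub_distrib]
    linarith
  have ha : (fun j : Fin k => β j.succ - β' j.succ) = 0 := by
    by_contra hne
    refine hvar _ hne ?_
    rw [variance_congr (Y := fun _ => β' 0 - β 0) hd]
    simp [variance, evariance]
  have h0 : β 0 = β' 0 := by
    obtain ⟨x, hx⟩ := hd.exists
    have : ∀ j : Fin k, β j.succ - β' j.succ = 0 := fun j => congrFun ha j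
    simp only [this, zero_mul, Finset.sum_const_zero] at hx
    linarith
  funext j
  refine Fin.cases h0 (fun j => ?_) j
  exact sub_eq_zero.1 (congrFun ha j)

/-! ### Consistency of maximizers over a compact set -/

/-- Wald's consistency theorem for maximizers of a sum `∑ φ θ (Z i)` over a compact set of
parameters `θ`. -/
theorem tendstoInMeasure_of_forall_integral_lt {Ω E T : Type*} [MeasurableSpace Ω]
    [MeasurableSpace E] [PseudoMetricSpace T] {μ : Measure Ω} [IsProbabilityMeasure μ]
    {Z : ℕ → Ω → E} (hZ : ∀ i, Measurable (Z i)) (hindep : iIndepFun Z μ)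
    (hident : ∀ i, IdentDistrib (Z i) (Z 0) μ μ)
    {C : Set T} (hC : IsCompact C) {θ₀ : T} (hθ₀ : θ₀ ∈ C) {φ : T → E → ℝ}
    (hφ : ∀ θ, Measurable (φ θ)) (hint : ∀ θ ∈ C, Integrable (fun ω => φ θ (Z 0 ω)) μ)
    {K : Set E} (hK : ∀ i, ∀ᵐ ω ∂μ, Z i ω ∈ K)
    (hunif : ∀ ε > 0, ∃ ρ > 0, ∀ θ ∈ C, ∀ θ' ∈ C, dist θ' θ < ρ → ∀ z ∈ K, φ θ' z ≤ φ θ z + ε)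
    (hlt : ∀ θ ∈ C, dist θ θ₀ ≠ 0 → ∫ ω, φ θ (Z 0 ω) ∂μ < ∫ ω, φ θ₀ (Z 0 ω) ∂μ)
    {θhat : ℕ → Ω → T}
    (hmax : ∀ n, 1 ≤ n → ∀ᵐ ω ∂μ, θhat n ω ∈ C ∧
      ∑ i ∈ Finset.range n, φ θ₀ (Z i ω) ≤ ∑ i ∈ Finset.range n, φ (θhat n ω) (Z i ω)) :
    TendstoInMeasure μ θhat atTop (fun _ => θ₀) := by
  set m : T → ℝ := fun θ => ∫ ω, φ θ (Z 0 ω) ∂μ with hm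
  have hlln : ∀ θ ∈ C, ∀ ε > 0, Tendsto (fun n : ℕ => μ {ω | ε ≤
      dist ((∑ i ∈ Finset.range n, φ θ (Z i ω)) / n) (m θ)}) atTop (nhds 0) := by
    intro θ hθ ε hε
    have hae := strong_law_ae_real (fun i ω => φ θ (Z i ω)) (hint θ hθ)
      (fun i j hij => (hindep.indepFun hij).comp (hφ θ) (hφ θ))
      (fun i => (hident i).comp (hφ θ))
    refine tendstoInMeasure_iff_dist.1 (tendstoInMeasure_of_tendsto_ae (fun n => ?_) hae) ε hε
    exact (Measurable.div_const (Finset.measurable_sum _ fun i _ =>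
      (hφ θ).comp (hZ i)) _).aestronglyMeasurable
  rw [tendstoInMeasure_iff_dist]
  intro ε hε
  have hcpt : IsCompact (C \ Metric.ball θ₀ ε) := hC.diff Metric.isOpen_ball
  have hgap : ∀ θ ∈ C \ Metric.ball θ₀ ε, 0 < (m θ₀ - m θ) / 3 := by
    intro θ hθ
    have hd : dist θ θ₀ ≠ 0 := by
      intro h
      exact hθ.2 (by rw [Metric.mem_ball, h]; exact hε)
    linarith [hlt θ hθ.1 hd]
  have hrad : ∀ θ, ∃ ρ > 0, θ ∈ C \ Metric.ball θ₀ ε → ∀ θ' ∈ C, dist θ' θ < ρ → ∀ z ∈ K,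
      φ θ' z ≤ φ θ z + (m θ₀ - m θ) / 3 := by
    intro θ
    by_cases hθ : θ ∈ C \ Metric.ball θ₀ ε
    · obtain ⟨ρ, hρ, h⟩ := hunif _ (hgap θ hθ)
      exact ⟨ρ, hρ, fun _ => h θ hθ.1⟩
    -- A dummy radius, so that `choose` yields a function of all `θ`.
    · exact ⟨1, one_pos, fun h => absurd h hθ⟩
  choose ρ hρ hρφ using hrad
  obtain ⟨t, htC, ht⟩ := hcpt.elim_nhds_subcover (fun θ => Metric.ball θ (ρ θ))
    fun θ _ => Metric.ball_mem_nhds θ (hρ θ)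
  set bad : T → T → ℕ → Set Ω := fun θ θ' n => {ω | (m θ₀ - m θ) / 3 ≤
      dist ((∑ i ∈ Finset.range n, φ θ' (Z i ω)) / n) (m θ')} with hbad
  have hsum : Tendsto (fun n => ∑ θ ∈ t, (μ (bad θ θ n) + μ (bad θ θ₀ n))) atTop (nhds 0) := by
    have : Tendsto (fun n => ∑ θ ∈ t, (μ (bad θ θ n) + μ (bad θ θ₀ n))) atTop
        (nhds (∑ θ ∈ t, (0 + 0))) :=
      tendsto_finsetSum _ fun θ hθ => (hlln θ (htC θ hθ).1 _ (hgap θ (htC θ hθ))).add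
        (hlln θ₀ hθ₀ _ (hgap θ (htC θ hθ)))
    simpa using this
  refine tendsto_of_tendsto_of_tendsto_of_le_of_le' tendsto_const_nhds hsum
    (Eventually.of_forall fun n => zero_le) ?_
  filter_upwards [eventually_ge_atTop 1] with n hn
  -- Comparison of outer measures, so no measurability of `θhat` enters.
  have hsub : μ {ω | ε ≤ dist (θhat n ω) θ₀} ≤ μ (⋃ θ ∈ t, bad θ θ n ∪ bad θ θ₀ n) := by
    refine measure_mono_ae ?_
    filter_upwards [hmax n hn, ae_all_iff.2 hK] with ω hω hωK hdist
    have hmem : θhat n ω ∈ C \ Metric.ball θ₀ ε :=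
      ⟨hω.1, fun h => not_lt.2 hdist (Metric.mem_ball.1 h)⟩
    obtain ⟨θ, hθt, hθ⟩ := Set.mem_iUnion₂.1 (ht hmem)
    refine Set.mem_iUnion₂.2 ⟨θ, hθt, ?_⟩
    by_contra hcon
    simp only [hbad, Set.mem_union, Set.mem_ofPred_eq, not_or, not_le] at hcon
    obtain ⟨h1, h2⟩ := hcon
    rw [Real.dist_eq] at h1 h2
    have hn0 : (0 : ℝ) < n := by exact_mod_cast hn
    have h3 : ∑ i ∈ Finset.range n, φ (θhat n ω) (Z i ω) ≤
        ∑ i ∈ Finset.range n, φ θ (Z i ω) + n * ((m θ₀ - m θ) / 3) := by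
      have := Finset.sum_le_sum fun i (_ : i ∈ Finset.range n) =>
        hρφ θ (htC θ hθt) (θhat n ω) hω.1 hθ (Z i ω) (hωK i)
      simpa [Finset.sum_add_distrib] using this
    have h4 := (hω.2.trans h3)
    have h5 : (∑ i ∈ Finset.range n, φ θ₀ (Z i ω)) / n ≤
        (∑ i ∈ Finset.range n, φ θ (Z i ω)) / n + (m θ₀ - m θ) / 3 := by
      rw [div_le_iff₀ hn0, add_mul, div_mul_cancel₀ _ hn0.ne']
      linarith
    -- One third of the gap `m θ₀ - m θ` pays for moving to the centre `θ`, and less than one third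
    -- for each of the two averages: the total falls short of the gap.
    linarith [(abs_lt.1 h1).2, (abs_lt.1 h2).1]
  refine hsub.trans ((measure_biUnion_finset_le _ _).trans ?_)
  exact Finset.sum_le_sum fun θ _ => measure_union_le _ _

/-! ### Gibbs' inequality and the expected log-likelihood -/

theorem MeasureTheory.Measure.ext_prod_countable {α β : Type*} [MeasurableSpace α]
    [MeasurableSpace β] [Countable β] [MeasurableSingletonClass β] {μ ν : Measure (α × β)}
    [IsFiniteMeasure μ]
    (h : ∀ (s : Set α) (b : β), MeasurableSet s → μ (s ×ˢ {b}) = ν (s ×ˢ {b})) : μ = ν := by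
  refine Measure.ext_prod fun {s t} hs ht => ?_
  have hst : s ×ˢ t = ⋃ b ∈ t, s ×ˢ ({b} : Set β) := by
    ext ⟨a, b⟩
    simp [and_comm]
  have hd : t.PairwiseDisjoint fun b => s ×ˢ ({b} : Set β) := fun b _ b' _ hb =>
    Set.disjoint_left.2 fun z hz hz' => hb (hz.2.symm.trans hz'.2)
  have hm : ∀ b ∈ t, MeasurableSet (s ×ˢ ({b} : Set β)) := fun b _ =>
    hs.prod (measurableSet_singleton b)
  rw [hst, measure_biUnion (Set.to_countable t) hd hm, measure_biUnion (Set.to_countable t) hd hm]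
  exact tsum_congr fun b => h s b hs

theorem Continuous.integrable_of_ae_mem_isCompact {E : Type*} [TopologicalSpace E]
    [MeasurableSpace E] [BorelSpace E] {g : Measure E} [IsFiniteMeasure g] {K : Set E}
    (hK : IsCompact K) (hgK : ∀ᵐ x ∂g, x ∈ K) {f : E → ℝ} (hf : Continuous f) :
    Integrable f g := by
  obtain ⟨B, hB⟩ := hK.exists_bound_of_continuousOn hf.continuousOn
  exact Integrable.of_bound hf.measurable.aestronglyMeasurable B (hgK.mono hB)

theorem sum_fbRegPmf {k : ℕ} (N : ℕ) (Θ : FBParam k) (x : Fin k → ℝ) :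
    ∑ y ∈ Finset.range (N + 1), fbRegPmf N Θ x y = 1 :=
  sum_fbPmf _ _ _ N

theorem fbRegPmf_nonneg {k : ℕ} (N y : ℕ) (Θ : FBParam k) (x : Fin k → ℝ) :
    0 ≤ fbRegPmf N Θ x y := by
  by_cases hy : y ≤ N
  · exact (fbRegPmf_pos hy Θ x).le
  · exact (fbRegPmf_eq_zero (not_le.1 hy) Θ x).ge

theorem continuous_fbRegPmf_right {k : ℕ} (N y : ℕ) (Θ : FBParam k) :
    Continuous fun x => fbRegPmf N Θ x y :=
  Continuous.comp (g := fun z : FBParam k × (Fin k → ℝ) => fbRegPmf N z.1 z.2 y)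
    (f := fun x => (Θ, x)) (continuous_fbRegPmf N y) (Continuous.prodMk_right Θ)

theorem continuous_log_fbRegPmf_uncurry {k : ℕ} (N : ℕ) :
    Continuous fun z : FBParam k × ((Fin k → ℝ) × ℕ) =>
      Real.log (fbRegPmf N z.1 z.2.1 z.2.2) := by
  have h : Continuous fun z : (FBParam k × (Fin k → ℝ)) × ℕ =>
      Real.log (fbRegPmf N z.1.1 z.1.2 z.2) :=
    continuous_prod_of_discrete_right.2 fun y => continuous_log_fbRegPmf N y
  exact Continuous.comp (f := fun z : FBParam k × ((Fin k → ℝ) × ℕ) => ((z.1, z.2.1), z.2.2)) h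
    (by fun_prop)

/-- This is `log t ≤ t - 1` at `t = b / a`. Summed over `y`, the left sides cancel because both mass
functions have total `1`. -/
theorem mul_log_sub_log_ge {a b : ℝ} (ha : 0 < a) (hb : 0 < b) :
    a - b ≤ a * (Real.log a - Real.log b) := by
  have h := Real.log_le_sub_one_of_pos (div_pos hb ha)
  rw [Real.log_div hb.ne' ha.ne'] at h
  have : a * (Real.log b - Real.log a) ≤ a * (b / a - 1) := by gcongr
  have e : a * (b / a - 1) = b - a := by field_simp
  linarith

theorem eq_of_mul_log_sub_log_le {a b : ℝ} (ha : 0 < a) (hb : 0 < b)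
    (h : a * (Real.log a - Real.log b) ≤ a - b) : a = b := by
  by_contra hne
  have h1 := Real.log_lt_sub_one_of_pos (div_pos hb ha)
    (fun h' => hne ((div_eq_one_iff_eq ha.ne').1 h').symm)
  rw [Real.log_div hb.ne' ha.ne'] at h1
  have : a * (Real.log b - Real.log a) < a * (b / a - 1) := by gcongr
  have e : a * (b / a - 1) = b - a := by field_simp
  linarith

/-- Gibbs' inequality: the conditional Kullback-Leibler divergence is nonnegative. -/
theorem sum_fbRegPmf_mul_log_sub_nonneg {k : ℕ} (N : ℕ) (Θ₀ Θ : FBParam k) (x : Fin k → ℝ) :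
    0 ≤ ∑ y ∈ Finset.range (N + 1), fbRegPmf N Θ₀ x y *
      (Real.log (fbRegPmf N Θ₀ x y) - Real.log (fbRegPmf N Θ x y)) := by
  have : ∑ y ∈ Finset.range (N + 1), (fbRegPmf N Θ₀ x y - fbRegPmf N Θ x y) ≤
      ∑ y ∈ Finset.range (N + 1), fbRegPmf N Θ₀ x y *
        (Real.log (fbRegPmf N Θ₀ x y) - Real.log (fbRegPmf N Θ x y)) := by
    refine Finset.sum_le_sum fun y hy => ?_
    have hy' : y ≤ N := Nat.lt_succ_iff.1 (Finset.mem_range.1 hy)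
    exact mul_log_sub_log_ge (fbRegPmf_pos hy' _ _) (fbRegPmf_pos hy' _ _)
  rwa [Finset.sum_sub_distrib, sum_fbRegPmf, sum_fbRegPmf, sub_self] at this

theorem fbRegPmf_eq_of_sum_mul_log_sub_eq_zero {k N : ℕ} {Θ₀ Θ : FBParam k} {x : Fin k → ℝ}
    (h : ∑ y ∈ Finset.range (N + 1), fbRegPmf N Θ₀ x y *
      (Real.log (fbRegPmf N Θ₀ x y) - Real.log (fbRegPmf N Θ x y)) = 0) :
    ∀ y ≤ N, fbRegPmf N Θ₀ x y = fbRegPmf N Θ x y := by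
  have hle : ∀ y ∈ Finset.range (N + 1), fbRegPmf N Θ₀ x y - fbRegPmf N Θ x y ≤
      fbRegPmf N Θ₀ x y * (Real.log (fbRegPmf N Θ₀ x y) - Real.log (fbRegPmf N Θ x y)) := by
    intro y hy
    have hy' : y ≤ N := Nat.lt_succ_iff.1 (Finset.mem_range.1 hy)
    exact mul_log_sub_log_ge (fbRegPmf_pos hy' _ _) (fbRegPmf_pos hy' _ _)
  have heq := (Finset.sum_eq_sum_iff_of_le hle).1 (by
    rw [h, Finset.sum_sub_distrib, sum_fbRegPmf, sum_fbRegPmf, sub_self])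
  intro y hy
  exact eq_of_mul_log_sub_log_le (fbRegPmf_pos hy _ _) (fbRegPmf_pos hy _ _)
    (heq y (by simpa using Nat.lt_succ_iff.2 hy)).ge

section Model

variable {Ω : Type*} [MeasurableSpace Ω] {μ : Measure Ω} [IsProbabilityMeasure μ] {k N : ℕ}
  {X : Ω → Fin k → ℝ} {Y : Ω → ℕ} {g : Measure (Fin k → ℝ)}
  {K : Set (Fin k → ℝ)} {Θ₀ : FBParam k}

theorem ae_le_of_fbRegPmf
    (hcond : ∀ (y : ℕ) (A : Set (Fin k → ℝ)), MeasurableSet A →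
      μ.real {ω | X ω ∈ A ∧ Y ω = y} = ∫ x in A, fbRegPmf N Θ₀ x y ∂g) :
    ∀ᵐ ω ∂μ, Y ω ≤ N := by
  have h : ∀ y : ℕ, ∀ᵐ ω ∂μ, N < y → Y ω ≠ y := by
    intro y
    by_cases hy : N < y
    · have := hcond y Set.univ MeasurableSet.univ
      simp only [fbRegPmf_eq_zero hy, integral_zero, Set.mem_univ, true_and] at this
      rw [measureReal_eq_zero_iff] at this
      rw [ae_iff]
      simpa [hy] using this
    · exact Eventually.of_forall fun _ h => absurd h hy
  filter_upwards [ae_all_iff.2 h] with ω hω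
  by_contra hlt
  exact hω (Y ω) (not_le.1 hlt) rfl

theorem map_restrict_eq_withDensity_fbRegPmf [IsProbabilityMeasure g] (hX : Measurable X)
    (hK : IsCompact K) (hgK : ∀ᵐ x ∂g, x ∈ K)
    (hcond : ∀ (y : ℕ) (A : Set (Fin k → ℝ)), MeasurableSet A →
      μ.real {ω | X ω ∈ A ∧ Y ω = y} = ∫ x in A, fbRegPmf N Θ₀ x y ∂g) (y : ℕ) :
    (μ.restrict {ω | Y ω = y}).map X =
      g.withDensity fun x => ENNReal.ofReal (fbRegPmf N Θ₀ x y) := by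
  have hint : Integrable (fun x => fbRegPmf N Θ₀ x y) g :=
    (continuous_fbRegPmf_right N y Θ₀).integrable_of_ae_mem_isCompact hK hgK
  ext A hA
  rw [Measure.map_apply hX hA, Measure.restrict_apply (hX hA), withDensity_apply _ hA,
    ← ofReal_integral_eq_lintegral_ofReal hint.integrableOn
      (Eventually.of_forall fun x => fbRegPmf_nonneg N y Θ₀ x), ← hcond y A hA,
    ofReal_measureReal]
  rfl

/-- Conditioning on the covariate: on each event `Y = y` the law of `X` has density `fbRegPmf N Θ₀ ·
y` with respect to `g`. -/
theorem integral_eq_sum_integral_fbRegPmf_mul [IsProbabilityMeasure g] (hX : Measurable X)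
    (hY : Measurable Y) (hlaw : μ.map X = g) (hK : IsCompact K) (hgK : ∀ᵐ x ∂g, x ∈ K)
    (hcond : ∀ (y : ℕ) (A : Set (Fin k → ℝ)), MeasurableSet A →
      μ.real {ω | X ω ∈ A ∧ Y ω = y} = ∫ x in A, fbRegPmf N Θ₀ x y ∂g)
    {f : (Fin k → ℝ) → ℕ → ℝ} (hf : ∀ y, Continuous fun x => f x y) :
    ∫ ω, f (X ω) (Y ω) ∂μ =
      ∫ x, ∑ y ∈ Finset.range (N + 1), fbRegPmf N Θ₀ x y * f x y ∂g := by
  have hYm : ∀ y, MeasurableSet {ω | Y ω = y} := fun y => hY (measurableSet_singleton y)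
  have hae : ∀ᵐ ω ∂μ, f (X ω) (Y ω) =
      ∑ y ∈ Finset.range (N + 1), {ω | Y ω = y}.indicator (fun ω => f (X ω) y) ω := by
    filter_upwards [ae_le_of_fbRegPmf hcond] with ω hω
    rw [Finset.sum_eq_single (Y ω)]
    · simp
    · intro y _ hy
      exact Set.indicator_of_notMem (fun h => hy (Eq.symm h)) _
    · intro h
      exact absurd (Finset.mem_range.2 (Nat.lt_succ_iff.2 hω)) h
  have hfX : ∀ y, Integrable (fun ω => f (X ω) y) μ := by
    intro y
    have : Integrable (fun x => f x y) (μ.map X) := by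
      rw [hlaw]
      exact (hf y).integrable_of_ae_mem_isCompact hK hgK
    exact this.comp_measurable hX
  have hfg : ∀ y, Integrable (fun x => fbRegPmf N Θ₀ x y * f x y) g := fun y =>
    ((continuous_fbRegPmf_right N y Θ₀).mul (hf y)).integrable_of_ae_mem_isCompact hK hgK
  rw [integral_congr_ae hae, integral_finsetSum _ fun y _ => (hfX y).indicator (hYm y),
    integral_finsetSum _ fun y _ => hfg y]
  refine Finset.sum_congr rfl fun y _ => ?_
  rw [integral_indicator (hYm y),
    ← integral_map (φ := X) (f := fun x => f x y) hX.aemeasurable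
      (hf y).measurable.aestronglyMeasurable,
    map_restrict_eq_withDensity_fbRegPmf hX hK hgK hcond y,
    integral_withDensity_eq_integral_toReal_smul
      (continuous_fbRegPmf_right N y Θ₀).measurable.ennreal_ofReal (by simp)]
  refine integral_congr_ae (Eventually.of_forall fun x => ?_)
  simp [ENNReal.toReal_ofReal (fbRegPmf_nonneg N y Θ₀ x)]

/-- The true parameter is the unique maximizer of the expected log-likelihood. -/
theorem integral_log_fbRegPmf_lt [IsProbabilityMeasure g] (hN : 3 ≤ N) (hX : Measurable X)
    (hY : Measurable Y) (hlaw : μ.map X = g) (hK : IsCompact K) (hgK : ∀ᵐ x ∂g, x ∈ K)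
    (hvar : ∀ a : Fin k → ℝ, a ≠ 0 → variance (fun x : Fin k → ℝ => ∑ j, a j * x j) g ≠ 0)
    (hcond : ∀ (y : ℕ) (A : Set (Fin k → ℝ)), MeasurableSet A →
      μ.real {ω | X ω ∈ A ∧ Y ω = y} = ∫ x in A, fbRegPmf N Θ₀ x y ∂g)
    {Θ : FBParam k} (hΘ : Θ ≠ Θ₀) :
    ∫ ω, Real.log (fbRegPmf N Θ (X ω) (Y ω)) ∂μ <
      ∫ ω, Real.log (fbRegPmf N Θ₀ (X ω) (Y ω)) ∂μ := by
  have hlog : ∀ (Θ : FBParam k) (y : ℕ), Continuous fun x => Real.log (fbRegPmf N Θ x y) :=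
    fun Θ y => Continuous.comp
      (g := fun z : FBParam k × (Fin k → ℝ) => Real.log (fbRegPmf N z.1 z.2 y))
      (f := fun x => (Θ, x)) (continuous_log_fbRegPmf N y) (Continuous.prodMk_right Θ)
  have hint : ∀ Θ : FBParam k, Integrable (fun x => ∑ y ∈ Finset.range (N + 1),
      fbRegPmf N Θ₀ x y * Real.log (fbRegPmf N Θ x y)) g := fun Θ =>
    (continuous_finsetSum _ fun y _ => (continuous_fbRegPmf_right N y Θ₀).mul
      (hlog Θ y)).integrable_of_ae_mem_isCompact hK hgK
  rw [integral_eq_sum_integral_fbRegPmf_mul hX hY hlaw hK hgK hcond (hlog Θ),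
    integral_eq_sum_integral_fbRegPmf_mul hX hY hlaw hK hgK hcond (hlog Θ₀), ← sub_pos,
    ← integral_sub (hint Θ₀) (hint Θ)]
  simp only [← Finset.sum_sub_distrib, ← mul_sub]
  have hnonneg := sum_fbRegPmf_mul_log_sub_nonneg N Θ₀ Θ
  refine lt_of_le_of_ne (integral_nonneg hnonneg) fun h => hΘ ?_
  have hi := (hint Θ₀).sub (hint Θ)
  simp only [Pi.sub_def, ← Finset.sum_sub_distrib, ← mul_sub] at hi
  -- Equality makes the conditional divergence vanish for almost every `x`, so the two conditional
  -- laws coincide there.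
  have h0 := (integral_eq_zero_iff_of_nonneg hnonneg hi).1 h.symm
  have hlin : ∀ᵐ x ∂g, linPred Θ₀.1 x = linPred Θ.1 x ∧ linPred Θ₀.2.1 x = linPred Θ.2.1 x ∧
      linPred Θ₀.2.2 x = linPred Θ.2.2 x := by
    filter_upwards [h0] with x hx
    exact linPred_eq_of_fbRegPmf_eq hN (fbRegPmf_eq_of_sum_mul_log_sub_eq_zero hx)
  have h1 := eq_of_linPred_ae_eq hvar (hlin.mono fun x hx => hx.1)
  have h2 := eq_of_linPred_ae_eq hvar (hlin.mono fun x hx => hx.2.1)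
  have h3 := eq_of_linPred_ae_eq hvar (hlin.mono fun x hx => hx.2.2)
  exact (Prod.ext h1 (Prod.ext h2 h3)).symm

end Model

/-! ### Consistency of the maximum likelihood estimator -/

theorem sum_log_fbRegPmf_le_of_isFBMLE {k N n : ℕ} {C : Set (FBParam k)} {x : ℕ → Fin k → ℝ}
    {y : ℕ → ℕ} (hy : ∀ i, y i ≤ N) {Θ₀ Θ : FBParam k} (hΘ₀ : Θ₀ ∈ C)
    (h : IsFBMLE N n C x y Θ) :
    ∑ i ∈ Finset.range n, Real.log (fbRegPmf N Θ₀ (x i) (y i)) ≤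
      ∑ i ∈ Finset.range n, Real.log (fbRegPmf N Θ (x i) (y i)) := by
  rw [← Real.log_prod fun i _ => (fbRegPmf_pos (hy i) _ _).ne',
    ← Real.log_prod fun i _ => (fbRegPmf_pos (hy i) _ _).ne']
  exact Real.log_le_log (Finset.prod_pos fun i _ => fbRegPmf_pos (hy i) _ _) (h.2 hΘ₀)

theorem theorem3p3 {Ω : Type*} [MeasurableSpace Ω] (μ : Measure Ω) [IsProbabilityMeasure μ]
    (k N : ℕ) (hN : 3 ≤ N)
    -- covariates `X i` and responses `Y i`; the observations `(X i, Y i)` are independent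
    (X : ℕ → Ω → Fin k → ℝ) (Y : ℕ → Ω → ℕ)
    (hX : ∀ i, Measurable (X i)) (hY : ∀ i, Measurable (Y i))
    (hindep : iIndepFun (fun i ω => (X i ω, Y i ω)) μ)
    -- the covariates have the common law `g`, carried by a compact set
    (g : Measure (Fin k → ℝ)) (hlaw : ∀ i, μ.map (X i) = g)
    (K : Set (Fin k → ℝ)) (hK : IsCompact K) (hgK : ∀ᵐ x ∂g, x ∈ K)
    -- no nontrivial linear combination of the covariates is degenerate
    (hvar : ∀ a : Fin k → ℝ, a ≠ 0 → variance (fun x : Fin k → ℝ => ∑ j, a j * x j) g ≠ 0)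
    -- the true parameter lies in the known compact set `C`
    (C : Set (FBParam k)) (hC : IsCompact C) (Θ₀ : FBParam k) (hΘ₀ : Θ₀ ∈ C)
    -- the conditional law of `Y i` given `X i = x` is fractional binomial with parameter `Θ₀`
    (hcond : ∀ (i y : ℕ) (A : Set (Fin k → ℝ)), MeasurableSet A →
      μ.real {ω | X i ω ∈ A ∧ Y i ω = y} = ∫ x in A, fbRegPmf N Θ₀ x y ∂g)
    -- `Θhat n` maximizes the likelihood of the first `n` observations over `C`
    (Θhat : ℕ → Ω → FBParam k)
    (hMLE : ∀ n, 1 ≤ n →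
      ∀ᵐ ω ∂μ, IsFBMLE N n C (fun i => X i ω) (fun i => Y i ω) (Θhat n ω)) :
    TendstoInMeasure μ Θhat atTop (fun _ => Θ₀) := by
  have hg : IsProbabilityMeasure g := by
    rw [← hlaw 0]
    exact Measure.isProbabilityMeasure_map (hX 0).aemeasurable
  have hZ : ∀ i, Measurable fun ω => (X i ω, Y i ω) := fun i => (hX i).prodMk (hY i)
  have hident : ∀ i, IdentDistrib (fun ω => (X i ω, Y i ω)) (fun ω => (X 0 ω, Y 0 ω)) μ μ := by
    intro i
    refine ⟨(hZ i).aemeasurable, (hZ 0).aemeasurable, ?_⟩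
    have := Measure.isFiniteMeasure_map μ fun ω => (X i ω, Y i ω)
    refine Measure.ext_prod_countable fun A y hA => ?_
    have hS := hA.prod (measurableSet_singleton y)
    rw [Measure.map_apply (hZ i) hS, Measure.map_apply (hZ 0) hS,
      ← measureReal_eq_measureReal_iff]
    exact (hcond i y A hA).trans (hcond 0 y A hA).symm
  have hYN : ∀ i, ∀ᵐ ω ∂μ, Y i ω ≤ N := fun i => ae_le_of_fbRegPmf (hcond i)
  have hKmem : ∀ i, ∀ᵐ ω ∂μ, (X i ω, Y i ω) ∈ K ×ˢ Set.Iic N := by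
    intro i
    have hXK : ∀ᵐ ω ∂μ, X i ω ∈ K := by
      rw [← hlaw i] at hgK
      exact ae_of_ae_map (hX i).aemeasurable hgK
    filter_upwards [hXK, hYN i] with ω h1 h2 using ⟨h1, h2⟩
  have hKc : IsCompact (K ×ˢ Set.Iic N) := hK.prod (Set.finite_Iic N).isCompact
  have hcont := continuous_log_fbRegPmf_uncurry (k := k) N
  have hφ : ∀ Θ : FBParam k, Continuous fun z : (Fin k → ℝ) × ℕ =>
      Real.log (fbRegPmf N Θ z.1 z.2) := fun Θ =>
    Continuous.comp (f := fun z : (Fin k → ℝ) × ℕ => (Θ, z)) hcont (Continuous.prodMk_right Θ)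
  refine tendstoInMeasure_of_forall_integral_lt (Z := fun i ω => (X i ω, Y i ω)) hZ hindep
    hident hC hΘ₀ (φ := fun Θ z => Real.log (fbRegPmf N Θ z.1 z.2))
    (fun Θ => (hφ Θ).measurable) (fun Θ _ => ?_) hKmem (fun ε hε => ?_) (fun Θ _ hΘ => ?_)
    (fun n hn => ?_)
  · obtain ⟨B, hB⟩ := hKc.exists_bound_of_continuousOn (hφ Θ).continuousOn
    exact Integrable.of_bound ((hφ Θ).measurable.comp (hZ 0)).aestronglyMeasurable B
      ((hKmem 0).mono fun ω hω => hB _ hω)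
  -- Joint continuity on the compact product of `C`, `K` and `{0, …, N}` gives one radius for all
  -- observations.
  · obtain ⟨ρ, hρ, h⟩ := Metric.uniformContinuousOn_iff.1
      ((hC.prod hKc).uniformContinuousOn_of_continuous hcont.continuousOn) ε hε
    refine ⟨ρ, hρ, fun Θ hΘ Θ' hΘ' hd z hz => ?_⟩
    have := h (Θ', z) ⟨hΘ', hz⟩ (Θ, z) ⟨hΘ, hz⟩ (by
      rw [Prod.dist_eq, dist_self]
      exact max_lt hd hρ)
    rw [Real.dist_eq] at this
    linarith [(abs_lt.1 this).2]
  · exact integral_log_fbRegPmf_lt hN (hX 0) (hY 0) (hlaw 0) hK hgK hvar (hcond 0)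
      (dist_ne_zero.1 hΘ)
  · filter_upwards [hMLE n hn, ae_all_iff.2 hYN] with ω hω hωN
    exact ⟨hω.1, sum_log_fbRegPmf_le_of_isFBMLE hωN hΘ₀ hω⟩
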